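/- Setting. Consider a discounted Markov decision process with state space $\mathbb{R}^d$ ($d\ge 1$, Euclidean norm), finite non-empty action set $\mathcal{A}$, Markov transition kernel $p(\cdot\mid s,a)$, measurable rewards $R(s,a)\in[0,R_{\max}]$, $R_{\max}>0$, and discount factor $\gamma\in(0,1)$; put $V_{\max}=R_{\max}/(1-\gamma)$. Let $V^*(s)=\sup_\pi \mathbb{E}_\pi\big[\sum_{t\ge0}\gamma^tR(s_t,a_t)\mid s_0=s\big]$ (supremum over stationary randomized policies), $Q^*(s,a)=R(s,a)+\gamma\int V^*(s')\,p(ds'\mid s,a)$, $\mathcal{A}^*(s)=\arg\max_aQ^*(s,a)$, and let $\pi^*(\cdot\mid s)$ be uniform on $\mathcal{A}^*(s)$. Let $\Delta_{\min}=\inf_s\min_{a\notin\mathcal{A}^*(s)}\big(\max_bQ^*(s,b)-Q^*(s,a)\big)\in[0,\infty]$ (a minimum over the empty set being $\infty$), and let $0<\Delta<\infty$ with $\Delta\le\Delta_{\min}$ (for instance $\Delta=\Delta_{\min}$ if this is finite). Assume: (Lyapunov function) for some $\nu,\nu',B,\alpha>0$ there is a measurable $L:\mathbb{R}^d\to[0,\infty)$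 with $L(s)\to\infty$ as $\|s\|\to\infty$ and bounded sublevel sets such that for all $s,a$ the next state $s'\sim p(\cdot\mid s,a)$ satisfies $|L(s')-L(s)|\le\nu$ and $\|s'-s\|\le\nu'$ almost surely, and $\sum_a\pi^*(a\mid s)\int(L(s')-L(s))\,p(ds'\mid s,a)\le-\alpha$ whenever $L(s)>B$; (Lipschitz value) $|V^*(s)-V^*(s')|\le\zeta\|s-s'\|$ for all $s,s'$, with some $\zeta>0$. Policy. Given $\tau>0$, put $\delta=\tau^2$, $H=\lceil\log_\gamma\delta\rceil$, $\varepsilon=\frac{\delta V_{\max}(1-\gamma)}{2\zeta\gamma\sqrt d}$, and $$W(\delta)=\frac{\gamma^2}{(1-\gamma)^2\delta^2}\Big(\log\frac{2|\mathcal{A}|}{\delta}+d\log H+d\log^+\frac1\varepsilon\Big),\qquad \log^+x=\max(0,\log x).$$ Let $S_\varepsilon$ be any measurable map that sends each state to a closest point of the grid $(\varepsilon\mathbb{Z})^d$. Called at a state $s$, the oracle with parameters $C,H$ builds a tree of depth $H$ with root $s$: at each node $x$ of level less than $H$ it simulates, for each action $a$, $C$ independent next states $x_{a,1},\dots,x_{a,C}\sim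 p(\cdot\mid x,a)$ and makes $S_\varepsilon(x_{a,i})$ the children of $x$; whenever a state is visited again, its earlier samples are reused. With $\widehat V^H=0$ at the leaves, it backs up $\widehat Q^{h-1}(x,a)=R(x,a)+\frac{\gamma}{C}\sum_{i\le C}\widehat V^h(S_\varepsilon(x_{a,i}))$, $\widehat V^{h-1}(x)=\max_a\widehat Q^{h-1}(x,a)$, and returns $\widehat Q(s,\cdot)=\widehat Q^0(s,\cdot)$. At each time the policy calls the oracle at the current state with fresh randomness and draws the action $a$ with probability $e^{\widehat Q(s,a)/\tau}/\sum_be^{\widehat Q(s,b)/\tau}$. Let $$\tau(\alpha)=\min\Big\{\sqrt{\tfrac{\alpha}{24\nu}},\ \tfrac{1-\gamma}{8R_{\max}},\ \tfrac{(1-\gamma)\alpha}{48R_{\max}|\mathcal{A}|^2\nu},\ \tfrac{\Delta}{\ln(24\nu|\mathcal{A}|/\alpha)}\Big\}.$$ Theorem. There is a constant $K>0$, depending only on $d,\mathcal{A},\gamma,R_{\max},\nu'$, such that the following hold. 1. (Stability) If $0<\tau\le\tau(\alpha)$ and $C\ge K\,W(\delta)$, then the resulting stationary policy is stable: for each $\theta\in(0,1)$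 there is a bounded measurable set $D\subset\mathbb{R}^d$ such that for every $s$, $\limsup_{t\to\infty}\mathbb{P}(s_t\notin D\mid s_0=s)\le\theta$ and $\sup_{t\ge0}\mathbb{E}\big[\inf\{k\ge0:s_{t+k}\in D\}\mid s_t=s\big]<\infty$. 2. (Sample complexity) For all $\kappa\ge K$ and $c\in(0,1]$ there are $K',\alpha_0>0$, depending only on $\kappa,c,\nu,\zeta,\Delta$ and on $d,\mathcal{A},\gamma,R_{\max},\nu'$, such that if $\alpha<\alpha_0$, $c\,\tau(\alpha)\le\tau\le\tau(\alpha)$ and $C=\lceil\kappa W(\delta)\rceil$, then at every state the number of simulation steps used in one time step is almost surely at most $K'\alpha^{-(2d+4)}\log^{d+1}(1/\alpha)$. -/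

import Mathlib

open MeasureTheory ProbabilityTheory Filter Topology
open scoped ENNReal

noncomputable section

namespace StableRL

/-- The Euclidean space `ℝ^d`, which is the state space of the decision process. -/
abbrev State (d : ℕ) : Type := EuclideanSpace ℝ (Fin d)

/-- A discounted Markov decision process with state space `ℝ^d`, action space `A`,
discount factor `γ ∈ (0, 1)` and rewards in `[0, Rmax]`. -/
structure MDP (d : ℕ) (A : Type*) [MeasurableSpace A] (γ Rmax : ℝ) where
  /-- `trans (s, a)` is the law of the next state when action `a` is taken in state `s`. -/
  trans : Kernel (State d × A) (State d)
  isMarkov : IsMarkovKernel trans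
  reward : State d → A → ℝ
  measurable_reward : ∀ a, Measurable fun s => reward s a
  reward_nonneg : ∀ s a, 0 ≤ reward s a
  reward_le : ∀ s a, reward s a ≤ Rmax
  discount_pos : 0 < γ
  discount_lt_one : γ < 1

attribute [instance] MDP.isMarkov

/-- A (randomized) decision rule: `π s {a}` is the probability of action `a` in state `s`. -/
abbrev Policy (d : ℕ) (A : Type*) [MeasurableSpace A] : Type _ :=
  {π : Kernel (State d) A // IsMarkovKernel π}

instance {d : ℕ} {A : Type*} [MeasurableSpace A] (π : Policy d A) : IsMarkovKernel π.1 := π.2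

section Chains

variable {X : Type*} [MeasurableSpace X]

/-- The law of a (time-inhomogeneous) Markov chain `x 0, x 1, …` with initial law `μ` and with
`x (n + 1)` drawn from `κ n (x n)`. -/
def chainLaw (μ : Measure X) [IsProbabilityMeasure μ] (κ : ℕ → Kernel X X)
    [∀ n, IsMarkovKernel (κ n)] : Measure (ℕ → X) :=
  Kernel.trajMeasure (X := fun _ => X) μ fun n =>
    (κ n).comap (fun x : (Finset.Iic n → X) => x ⟨n, Finset.mem_Iic.2 le_rfl⟩)
      (measurable_pi_apply _)

/-- The first time at which the trajectory `x` is in `D`, and `∞` if there is none. -/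
def hittingTime (D : Set X) (x : ℕ → X) : ℝ≥0∞ :=
  ⨅ (k : ℕ) (_ : x k ∈ D), (k : ℝ≥0∞)

end Chains

namespace MDP

variable {d : ℕ} {A : Type*} [MeasurableSpace A] {γ Rmax : ℝ}

/-- The law of `(s_0, a_0), (s_1, a_1), …` under the stationary policy `π`, started at `s_0 = s`. -/
def stateActionLaw (M : MDP d A γ Rmax) (π : Policy d A) (s : State d) :
    Measure (ℕ → State d × A) :=
  chainLaw ((Kernel.id ×ₖ π.1) s) fun _ => (Kernel.id ×ₖ π.1) ∘ₖ M.trans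

/-- The value function `V^π(s) = E_π[∑ γ^t R(s_t, a_t) | s_0 = s]` of a stationary policy. -/
def value (M : MDP d A γ Rmax) (π : Policy d A) (s : State d) : ℝ :=
  ∫ x, ∑' t : ℕ, γ ^ t * M.reward (x t).1 (x t).2 ∂(M.stateActionLaw π s)

/-- The optimal value function `V^*`. -/
def optValue (M : MDP d A γ Rmax) (s : State d) : ℝ :=
  ⨆ π : Policy d A, M.value π s

/-- The optimal `Q`-function `Q^*`. -/
def optQ (M : MDP d A γ Rmax) (s : State d) (a : A) : ℝ :=
  M.reward s a + γ * ∫ s', M.optValue s' ∂(M.trans (s, a))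

/-- The set `A^*(s)` of optimal actions in state `s`. -/
def optActions (M : MDP d A γ Rmax) (s : State d) : Set A :=
  {a | ∀ b, M.optQ s b ≤ M.optQ s a}

open Classical in
/-- The optimal policy `π^*(a | s)`, which is uniform on the optimal actions. -/
def optPolicy (M : MDP d A γ Rmax) (s : State d) (a : A) : ℝ :=
  if a ∈ M.optActions s then ((M.optActions s).ncard : ℝ)⁻¹ else 0

/-- The gap in state `s` between the optimal and the best non-optimal action
(`∞` if all actions are optimal in `s`). -/
def gap (M : MDP d A γ Rmax) (s : State d) : EReal :=
  ⨅ (a : A) (_ : a ∉ M.optActions s), (((⨆ b, M.optQ s b) - M.optQ s a : ℝ) : EReal)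

/-- The minimum gap over all states. -/
def minGap (M : MDP d A γ Rmax) : EReal :=
  ⨅ s, M.gap s

/-- The chain induced by the optimal policy respects the Lyapunov function `L`, with increment
bounds `ν` (for `L`) and `ν'` (for the state), and with drift at most `-α` where `L > B`. -/
structure IsLyapunov [Fintype A] (M : MDP d A γ Rmax) (L : State d → ℝ) (ν ν' B α : ℝ) :
    Prop where
  ν_pos : 0 < ν
  ν'_pos : 0 < ν'
  B_pos : 0 < B
  α_pos : 0 < α
  measurable : Measurable L
  nonneg : ∀ s, 0 ≤ L s
  tendsto : Tendsto L (Bornology.cobounded (State d)) atTop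
  bounded : ∀ l : ℝ, Bornology.IsBounded {s | L s ≤ l}
  increment : ∀ s a, ∀ᵐ s' ∂(M.trans (s, a)), |L s' - L s| ≤ ν ∧ ‖s' - s‖ ≤ ν'
  drift : ∀ s, B < L s →
    ∑ a, M.optPolicy s a * ∫ s', (L s' - L s) ∂(M.trans (s, a)) ≤ -α

/-- The optimal value function is Lipschitz with constant `ζ`. -/
def LipschitzValue (M : MDP d A γ Rmax) (ζ : ℝ) : Prop :=
  ∀ s s', |M.optValue s - M.optValue s'| ≤ ζ * ‖s - s'‖

/-- The transition kernel on states when actions are chosen by `π`. -/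
def step (M : MDP d A γ Rmax) (π : Policy d A) : Kernel (State d) (State d) :=
  M.trans ∘ₖ (Kernel.id ×ₖ π.1)

instance (M : MDP d A γ Rmax) (π : Policy d A) : IsMarkovKernel (M.step π) := by
  unfold step; infer_instance

/-- The law of `s_t, s_{t+1}, s_{t+2}, …` given `s_t = s`, when the decision rule `π n` is used at
each time `n`. -/
def stateLaw (M : MDP d A γ Rmax) (π : ℕ → Policy d A) (t : ℕ) (s : State d) :
    Measure (ℕ → State d) :=
  chainLaw (Measure.dirac s) fun n => M.step (π (t + n))

/-- Stability of a policy `{π^t, t ≥ 0}`: for all `θ ∈ (0, 1)` there is a bounded set of states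
outside of which the state lies with asymptotic probability at most `θ`, and to which it returns
in finite expected time, uniformly in the starting time. -/
def IsStable (M : MDP d A γ Rmax) (π : ℕ → Policy d A) : Prop :=
  ∀ θ : ℝ, 0 < θ → θ < 1 → ∃ D : Set (State d), Bornology.IsBounded D ∧ MeasurableSet D ∧
    (∀ s, limsup (fun t : ℕ => M.stateLaw π 0 s {x | x t ∉ D}) atTop ≤ ENNReal.ofReal θ) ∧
    (∀ s, ⨆ t : ℕ, ∫⁻ x, hittingTime D x ∂(M.stateLaw π t s) < ∞)

end MDP

/-- The grid `(ε ℤ)^d`. -/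
def grid (d : ℕ) (ε : ℝ) : Set (State d) :=
  {g | ∀ i, ∃ k : ℤ, g i = k * ε}

/-- `S` is a (measurable) map that sends each state to a closest element of the grid. -/
structure IsNearestGridMap {d : ℕ} (ε : ℝ) (S : State d → State d) : Prop where
  measurable : Measurable S
  mem_grid : ∀ s, S s ∈ grid d ε
  dist_le : ∀ s, ∀ g ∈ grid d ε, ‖s - S s‖ ≤ ‖s - g‖

section Oracle

variable {d : ℕ} {A : Type*} [MeasurableSpace A] {γ Rmax : ℝ}

/-- The randomness of the simulator in one call of the oracle: `ω (x, a, i)` is the `i`-th simulated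
next state for the state-action pair `(x, a)`. All entries are independent, with
`ω (x, a, i)` of law `p(· | x, a)`. The oracle reads only the entries of the states that it visits;
a state that is visited again is read again, so that its samples are reused. -/
def MDP.samplesLaw (M : MDP d A γ Rmax) (C : ℕ) : Measure (State d × A × Fin C → State d) :=
  Measure.infinitePi fun j : State d × A × Fin C => M.trans (j.1, j.2.1)

/-- The backed-up estimate of the `Q`-value of `(x, a)` when `x` is `n` levels above the leaves.
At the leaves (`n = 0`) it is zero, so that the value assigned to a leaf is zero. -/
def MDP.oracleQ (M : MDP d A γ Rmax) {C : ℕ} (S : State d → State d)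
    (ω : State d × A × Fin C → State d) : ℕ → State d → A → ℝ
  | 0, _, _ => 0
  | n + 1, x, a =>
      M.reward x a + γ * ((1 / (C : ℝ)) * ∑ i, ⨆ b, M.oracleQ S ω n (S (ω (x, a, i))) b)

open Classical in
/-- The states at level `h` of the sampling tree with root `s`. -/
def treeLevel [Fintype A] {C : ℕ} (S : State d → State d) (ω : State d × A × Fin C → State d)
    (s : State d) : ℕ → Finset (State d)
  | 0 => {s}
  | h + 1 => (treeLevel S ω s h ×ˢ (Finset.univ : Finset (A × Fin C))).image fun j => S (ω j)

open Classical in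
/-- The number of simulation steps in a call of the oracle with depth `H` at the state `s`: each
distinct state at the levels `0, …, H - 1` is simulated `C` times for each action. -/
def sampleCount [Fintype A] {C : ℕ} (S : State d → State d) (ω : State d × A × Fin C → State d)
    (H : ℕ) (s : State d) : ℕ :=
  ((Finset.range H).biUnion (treeLevel S ω s)).card * (Fintype.card A * C)

/-- The Boltzmann distribution of temperature `τ` for the `Q`-values `q`. -/
def boltzmann [Fintype A] (τ : ℝ) (q : A → ℝ) (a : A) : ℝ :=
  Real.exp (q a / τ) / ∑ b, Real.exp (q b / τ)

/-- `π` is the stationary policy that in state `s` calls the oracle (with fresh randomness) and then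
draws an action from the Boltzmann distribution of the returned `Q`-values. -/
def MDP.IsOraclePolicy [Fintype A] (M : MDP d A γ Rmax) (τ : ℝ) (H C : ℕ) (S : State d → State d)
    (π : Policy d A) : Prop :=
  ∀ s a, (π.1 s).real {a} =
    ∫ ω, boltzmann τ (M.oracleQ S ω H s) a ∂(M.samplesLaw C)

end Oracle

/-- The threshold `τ(α)`, for a minimum gap `Δ` and `cA` actions. -/
def tauMax (γ Rmax ν Δ : ℝ) (cA : ℕ) (α : ℝ) : ℝ :=
  min (min (Real.sqrt (α / (24 * ν))) ((1 - γ) / (8 * Rmax)))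
    (min ((1 - γ) * α / (48 * Rmax * (cA : ℝ) ^ 2 * ν)) (Δ / Real.log (24 * ν * cA / α)))

/-- The depth `H = ⌈log_γ δ⌉`. -/
def depth (γ δ : ℝ) : ℕ := ⌈Real.logb γ δ⌉₊

/-- The mesh `ε = δ V_max (1 - γ) / (2 ζ γ √d)` with `V_max = R_max / (1 - γ)`. -/
def mesh (d : ℕ) (γ Rmax ζ δ : ℝ) : ℝ :=
  δ * (Rmax / (1 - γ)) * (1 - γ) / (2 * ζ * γ * Real.sqrt d)

/-- The order of the number `C` of samples per state-action pair:
`γ² / ((1 - γ)² δ²) * (log (2|A| / δ) + d log H + d log⁺ (1 / ε))`. -/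
def widthOrder (d : ℕ) (γ Rmax ζ : ℝ) (cA : ℕ) (δ : ℝ) : ℝ :=
  γ ^ 2 / ((1 - γ) ^ 2 * δ ^ 2) *
    (Real.log (2 * cA / δ) + d * Real.log (depth γ δ)
      + d * max 0 (Real.log (1 / mesh d γ Rmax ζ δ)))

end StableRL

end

/-! The oracle policy is shown to be so close to `π^*` that the Lyapunov drift survives with half
its size, and a drift on bounded increments gives stability through an exponential moment.

Oracle accuracy. Increments are bounded and the oracle rounds to a grid, so all states it can visit
from `s` lie in a finite set `G` fixed before any sampling, with at most about `(H / ε)^d` elements.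
Hoeffding's inequality and a union bound over `G × A` make every empirical mean of `V^*` accurate to
`η` outside an event of probability at most `δ`; no adaptivity of the tree enters, and reuse of
samples is harmless. With the Bellman optimality equation (`optValue_eq_ciSup_optQ`), each backup
maps an error `e` to `γ (e + ζβ + η)`, where `β` is the rounding distance. Iterating gives `|Q̂ -
Q^*| ≤ (3/2) δ V_max` (`abs_oracleQ_sub_optQ_le`).

Closeness of policies. The gap `Δ` gives non-optimal actions Boltzmann weight of order `exp (-Δ /
τ)`, while optimal ones exceed their share by at most the factor `exp (2e / τ)`. Since `δ = τ²`, the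
exponent `2e / τ` is `3 τ V_max`, which is small, and the four bounds in `τ(α)` give total distance
at most `α / (2ν)` (`policy_distance_le`).

Stability. Such a policy has drift at most `-α / 2` where `L > B`. For small `l`, `exp (l L)` then
contracts by a factor `ρ < 1` there, which yields both tightness and bounded mean return times
(`isStable_of_close`).

Complexity. `τ(α)` is at least a multiple of `α`, so `1 / δ` and `1 / ε` are `O(α⁻²)` and `H` is
`O(log (1 / α))`. Thus `|G|` is `O((α⁻² log (1 / α))^d)`, `C` is `O(α⁻⁴ log (1 / α))`, and their
product has the stated order (`exists_complexity_bound`). -/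

noncomputable section

set_option linter.unusedSectionVars false

namespace StableRL

/-! ### Markov chains: the one-step Markov property and marginals -/

section Chains

variable {X : Type*} [MeasurableSpace X] {μ : Measure X} [IsProbabilityMeasure μ]
  {κ : ℕ → Kernel X X} [∀ n, IsMarkovKernel (κ n)]

instance : IsProbabilityMeasure (chainLaw μ κ) := by
  unfold chainLaw; infer_instance

/-- The Markov property at time `n`, tested against functions of the past and of the next state. -/
lemma lintegral_chainLaw_mul_succ {n : ℕ} {F : (Finset.Iic n → X) → ℝ≥0∞} (hF : Measurable F)
    {g : X → ℝ≥0∞} (hg : Measurable g) :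
    ∫⁻ x, F (Preorder.frestrictLe n x) * g (x (n + 1)) ∂chainLaw μ κ =
      ∫⁻ x, F (Preorder.frestrictLe n x) * ∫⁻ y, g y ∂(κ n (x n)) ∂chainLaw μ κ := by
  have key := Kernel.map_frestrictLe_trajMeasure_compProd_eq_map_trajMeasure
    (X := fun _ => X) (μ₀ := μ) (κ := fun n =>
    (κ n).comap (fun x : (Finset.Iic n → X) => x ⟨n, Finset.mem_Iic.2 le_rfl⟩)
      (measurable_pi_apply _)) (a := n)
  change (chainLaw μ κ).map _ ⊗ₘ _ = (chainLaw μ κ).map _ at key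
  have hm : Measurable fun p : (Finset.Iic n → X) × X => F p.1 * g p.2 := by fun_prop
  have h1 := congrArg (fun m => ∫⁻ p, F p.1 * g p.2 ∂m) key
  rw [lintegral_map hm (by fun_prop), Measure.lintegral_compProd hm,
    lintegral_map (Measurable.lintegral_kernel_prod_right' hm) (by fun_prop)] at h1
  rw [← h1]
  refine lintegral_congr fun x => ?_
  change ∫⁻ b, F (Preorder.frestrictLe n x) * g b ∂(κ n (x n)) = _
  exact lintegral_const_mul _ hg

lemma map_eval_zero_chainLaw : (chainLaw μ κ).map (fun x => x 0) = μ := by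
  unfold chainLaw Kernel.trajMeasure
  rw [Measure.map_comp _ _ (measurable_pi_apply _)]
  have : (fun x : ℕ → X => x 0) =
      (fun y : Finset.Iic 0 → X => y ⟨0, by simp⟩) ∘ Preorder.frestrictLe (π := fun _ => X) 0 := rfl
  rw [this, Kernel.map_comp_right _ (Preorder.measurable_frestrictLe 0) (by fun_prop), Kernel.traj_map_frestrictLe,
    Kernel.partialTraj_self, ← Measure.map_comp _ _ (by fun_prop), Measure.id_comp,
    Measure.map_map (by fun_prop) (by fun_prop)]
  exact Measure.map_id

lemma map_eval_succ_chainLaw (n : ℕ) :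
    (chainLaw μ κ).map (fun x => x (n + 1)) = κ n ∘ₘ (chainLaw μ κ).map (fun x => x n) := by
  ext s hs
  have h := lintegral_chainLaw_mul_succ (μ := μ) (κ := κ) (n := n) (F := fun _ => 1)
    measurable_const (g := s.indicator 1) (measurable_one.indicator hs)
  simp only [one_mul] at h
  rw [Measure.map_apply (by fun_prop) hs, Measure.bind_apply hs (Kernel.aemeasurable _),
    lintegral_map (Kernel.measurable_coe _ hs) (by fun_prop)]
  rw [← lintegral_indicator_one (hs.preimage (by fun_prop))]
  refine Eq.trans (by rfl) (h.trans ?_)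
  refine lintegral_congr fun x => ?_
  rw [lintegral_indicator_one hs]

end Chains

/-- The tail-sum formula: a hitting time counts the `n` by which `D` has not yet been visited. -/
lemma hittingTime_le_tsum {X : Type*} (D : Set X) (x : ℕ → X) :
    hittingTime D x ≤ ∑' n : ℕ, Set.indicator {x : ℕ → X | ∀ k ≤ n, x k ∉ D} 1 x := by
  classical
  by_cases h : ∃ k, x k ∈ D
  · calc hittingTime D x ≤ (Nat.find h : ℝ≥0∞) := iInf₂_le (f := fun (k : ℕ) (_ : x k ∈ D) => (k : ℝ≥0∞)) _
          (Nat.find_spec h)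
      _ = ∑ n ∈ Finset.range (Nat.find h), 1 := by simp
      _ = ∑ n ∈ Finset.range (Nat.find h),
            Set.indicator {x : ℕ → X | ∀ k ≤ n, x k ∉ D} 1 x := by
          refine Finset.sum_congr rfl fun n hn => ?_
          rw [Set.indicator_of_mem, Pi.one_apply]
          intro k hk
          exact Nat.find_min h (lt_of_le_of_lt hk (Finset.mem_range.1 hn))
      _ ≤ _ := ENNReal.sum_le_tsum _
  · push Not at h
    have : ∀ n : ℕ, Set.indicator {x : ℕ → X | ∀ k ≤ n, x k ∉ D} (1 : (ℕ → X) → ℝ≥0∞) x = 1 :=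
      fun n =>
      Set.indicator_of_mem (show x ∈ {x : ℕ → X | ∀ k ≤ n, x k ∉ D} from fun k _ => h k) _
    simp [this]

/-- Used for the uniform policy, for `π^*` and for the oracle policy; in each case only
measurability of the weights needs work. -/
lemma exists_policy {d : ℕ} {A : Type*} [Fintype A] [MeasurableSpace A] [DiscreteMeasurableSpace A]
    {p : State d → A → ℝ} (hp : ∀ a, Measurable fun s => p s a) (h0 : ∀ s a, 0 ≤ p s a)
    (h1 : ∀ s, ∑ a, p s a = 1) :
    ∃ π : Policy d A, ∀ s a, (π.1 s).real {a} = p s a := by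
  let κ : Kernel (State d) A :=
    { toFun := fun s => ∑ a, ENNReal.ofReal (p s a) • Measure.dirac a
      measurable' := by
        refine Measure.measurable_of_measurable_coe _ fun t _ => ?_
        simp only [Measure.coe_finsetSum, Measure.coe_smul, Finset.sum_apply, Pi.smul_apply,
          smul_eq_mul]
        exact Finset.measurable_fun_sum _ fun a _ => (hp a).ennreal_ofReal.mul_const _ }
  have hκ : ∀ s, κ s = ∑ a, ENNReal.ofReal (p s a) • Measure.dirac a := fun s => rfl
  have hM : IsMarkovKernel κ := by
    refine ⟨fun s => ⟨?_⟩⟩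
    rw [hκ]
    simp only [Measure.coe_finsetSum, Measure.coe_smul, Finset.sum_apply, Pi.smul_apply,
      smul_eq_mul, measure_univ, mul_one]
    rw [← ENNReal.ofReal_sum_of_nonneg fun a _ => h0 s a, h1, ENNReal.ofReal_one]
  refine ⟨⟨κ, hM⟩, fun s a => ?_⟩
  change (κ s).real {a} = _
  rw [measureReal_def, hκ]
  simp only [Measure.coe_finsetSum, Measure.coe_smul, Finset.sum_apply, Pi.smul_apply,
    smul_eq_mul]
  rw [Finset.sum_eq_single a]
  · simp [h0]
  · intro b _ hb
    simp [hb]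
  · simp

/-! ### Bounded functions and discounted sums -/

section Bounded

variable {Ω : Type*} [MeasurableSpace Ω] {μ : Measure Ω} [IsProbabilityMeasure μ] {f : Ω → ℝ}
  {c : ℝ}

lemma integrable_of_measurable_of_mem_Icc (hf : Measurable f) (h : ∀ x, f x ∈ Set.Icc 0 c) :
    Integrable f μ :=
  Integrable.of_mem_Icc 0 c hf.aemeasurable (ae_of_all _ h)

lemma integral_mem_Icc (hf : Measurable f) (h : ∀ x, f x ∈ Set.Icc 0 c) :
    ∫ x, f x ∂μ ∈ Set.Icc 0 c := by
  refine ⟨integral_nonneg fun x => (h x).1, ?_⟩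
  calc ∫ x, f x ∂μ ≤ ∫ _, c ∂μ :=
        integral_mono (integrable_of_measurable_of_mem_Icc hf h) (integrable_const _)
          fun x => (h x).2
    _ = c := by simp

lemma hasSum_integral_discounted {γ : ℝ} (hγ0 : 0 < γ) (hγ1 : γ < 1) {f : ℕ → Ω → ℝ}
    (hf : ∀ t, Measurable (f t)) (h : ∀ t x, f t x ∈ Set.Icc 0 c) :
    HasSum (fun t => γ ^ t * ∫ x, f t x ∂μ) (∫ x, ∑' t, γ ^ t * f t x ∂μ) := by
  have hi : ∀ t, Integrable (fun x => γ ^ t * f t x) μ := fun t =>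
    (integrable_of_measurable_of_mem_Icc (hf t) (h t)).const_mul _
  have := hasSum_integral_of_summable_integral_norm hi ?_
  · simpa only [integral_const_mul] using this
  · refine Summable.of_nonneg_of_le (fun t => integral_nonneg fun x => norm_nonneg _) (fun t => ?_)
      ((summable_geometric_of_lt_one hγ0.le hγ1).mul_right c)
    have hn : ∀ x, ‖γ ^ t * f t x‖ = γ ^ t * f t x := fun x =>
      Real.norm_of_nonneg (mul_nonneg (by positivity) (h t x).1)
    simp only [hn, integral_const_mul]
    exact mul_le_mul_of_nonneg_left (integral_mem_Icc (hf t) (h t)).2 (by positivity)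

end Bounded

lemma integral_measure_comp {α β : Type*} [MeasurableSpace α] [MeasurableSpace β] {μ : Measure α}
    {κ : Kernel α β} {f : β → ℝ} (hf : Integrable f (κ ∘ₘ μ)) :
    ∫ y, f y ∂(κ ∘ₘ μ) = ∫ x, ∫ y, f y ∂(κ x) ∂μ := by
  have h : κ ∘ₘ μ = (κ ∘ₖ Kernel.const Unit μ) () := by
    rw [Kernel.comp_apply, Kernel.const_apply]
  rw [h] at hf ⊢
  rw [Kernel.integral_comp hf, Kernel.const_apply]

/-! ### Value and `Q`-functions of stationary policies -/

namespace MDP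

variable {d : ℕ} {A : Type*} [Fintype A] [MeasurableSpace A] [DiscreteMeasurableSpace A]
  {γ Rmax : ℝ} (M : MDP d A γ Rmax) (π : Policy d A)

lemma reward_mem_Icc (s : State d) (a : A) : M.reward s a ∈ Set.Icc 0 Rmax :=
  ⟨M.reward_nonneg s a, M.reward_le s a⟩

/-- The expected reward after `t` steps of the policy `π`, as a function of the initial state and
the initial action. -/
def rewardAt : ℕ → State d × A → ℝ
  | 0 => fun z => M.reward z.1 z.2
  | t + 1 => fun z => ∫ y, rewardAt t y ∂(((Kernel.id ×ₖ π.1) ∘ₖ M.trans) z)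

/-- The `Q`-function of the stationary policy `π`. -/
def policyQ (z : State d × A) : ℝ := ∑' t : ℕ, γ ^ t * M.rewardAt π t z

lemma measurable_rewardAt (t : ℕ) : Measurable (M.rewardAt π t) := by
  induction t with
  | zero => exact measurable_from_prod_countable_left fun a => M.measurable_reward a
  | succ t ih => exact ih.stronglyMeasurable.integral_kernel.measurable

instance (s : State d) : IsProbabilityMeasure (M.stateActionLaw π s) := by
  unfold stateActionLaw; infer_instance

lemma rewardAt_mem_Icc (t : ℕ) (z : State d × A) : M.rewardAt π t z ∈ Set.Icc 0 Rmax := by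
  induction t generalizing z with
  | zero => exact M.reward_mem_Icc _ _
  | succ t ih => exact integral_mem_Icc (M.measurable_rewardAt π t) ih

/-- One step of the chain can be traded for one step of the recursion defining `rewardAt`; the
induction on `n` therefore has to let `k` vary. -/
lemma integral_rewardAt_chainLaw (μ : Measure (State d × A)) [IsProbabilityMeasure μ] (k n : ℕ) :
    ∫ x, M.rewardAt π k (x n) ∂chainLaw μ (fun _ => (Kernel.id ×ₖ π.1) ∘ₖ M.trans) =
      ∫ z, M.rewardAt π (n + k) z ∂μ := by
  set κ : ℕ → Kernel (State d × A) (State d × A) := fun _ => (Kernel.id ×ₖ π.1) ∘ₖ M.trans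
  have hm : ∀ k n, ∫ x, M.rewardAt π k (x n) ∂chainLaw μ κ =
      ∫ z, M.rewardAt π k z ∂(chainLaw μ κ).map (fun x => x n) := fun k n => by
    rw [integral_map (measurable_pi_apply n).aemeasurable (M.measurable_rewardAt π k).aestronglyMeasurable]
  induction n generalizing k with
  | zero => rw [hm, map_eval_zero_chainLaw, zero_add]
  | succ n ih =>
    have : IsProbabilityMeasure ((chainLaw μ κ).map (fun x => x n)) :=
      Measure.isProbabilityMeasure_map (measurable_pi_apply n).aemeasurable
    rw [hm, map_eval_succ_chainLaw, integral_measure_comp]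
    · have := ih (k + 1)
      rw [hm] at this
      rw [add_right_comm]
      exact this
    · exact integrable_of_measurable_of_mem_Icc (M.measurable_rewardAt π k)
        (M.rewardAt_mem_Icc π k)

lemma hasSum_integral_policyQ (μ : Measure (State d × A)) [IsProbabilityMeasure μ] :
    HasSum (fun t => γ ^ t * ∫ z, M.rewardAt π t z ∂μ) (∫ z, M.policyQ π z ∂μ) :=
  hasSum_integral_discounted M.discount_pos M.discount_lt_one (M.measurable_rewardAt π)
    (M.rewardAt_mem_Icc π)

lemma value_eq_integral_policyQ (s : State d) :
    M.value π s = ∫ z, M.policyQ π z ∂((Kernel.id ×ₖ π.1) s) := by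
  have h := hasSum_integral_discounted (μ := M.stateActionLaw π s) M.discount_pos
    M.discount_lt_one (c := Rmax) (f := fun t x => M.rewardAt π 0 (x t))
    (fun t => (M.measurable_rewardAt π 0).comp (measurable_pi_apply t))
    (fun t x => M.rewardAt_mem_Icc π 0 _)
  have h2 := M.hasSum_integral_policyQ π ((Kernel.id ×ₖ π.1) s)
  refine h.unique ?_
  convert h2 using 3 with t
  exact M.integral_rewardAt_chainLaw π _ 0 t

lemma summable_policyQ (z : State d × A) : Summable fun t => γ ^ t * M.rewardAt π t z := by
  have := (M.hasSum_integral_policyQ π (Measure.dirac z)).summable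
  simpa only [integral_dirac' _ _ (M.measurable_rewardAt π _).stronglyMeasurable] using this

lemma measurable_policyQ : Measurable (M.policyQ π) :=
  Measurable.tsum fun t => (M.measurable_rewardAt π t).const_mul _

lemma policyQ_mem_Icc (z : State d × A) : M.policyQ π z ∈ Set.Icc 0 (Rmax / (1 - γ)) := by
  have h0 := M.discount_pos
  refine ⟨tsum_nonneg fun t => mul_nonneg (by positivity) (M.rewardAt_mem_Icc π t z).1, ?_⟩
  have hs := (hasSum_geometric_of_lt_one h0.le M.discount_lt_one).mul_right Rmax
  rw [div_eq_inv_mul]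
  exact hasSum_le (fun t => mul_le_mul_of_nonneg_left (M.rewardAt_mem_Icc π t z).2 (by positivity))
    (M.summable_policyQ π z).hasSum hs

lemma integrable_policyQ (μ : Measure (State d × A)) [IsProbabilityMeasure μ] :
    Integrable (M.policyQ π) μ :=
  integrable_of_measurable_of_mem_Icc (M.measurable_policyQ π) (M.policyQ_mem_Icc π)

lemma value_mem_Icc (s : State d) : M.value π s ∈ Set.Icc 0 (Rmax / (1 - γ)) := by
  rw [value_eq_integral_policyQ]
  exact integral_mem_Icc (M.measurable_policyQ π) (M.policyQ_mem_Icc π)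

lemma measurable_value : Measurable (M.value π) := by
  simp only [funext (M.value_eq_integral_policyQ π)]
  exact (M.measurable_policyQ π).stronglyMeasurable.integral_kernel.measurable

lemma policyQ_eq (s : State d) (a : A) :
    M.policyQ π (s, a) = M.reward s a + γ * ∫ s', M.value π s' ∂(M.trans (s, a)) := by
  have h := (M.hasSum_integral_policyQ π (((Kernel.id ×ₖ π.1) ∘ₖ M.trans) (s, a))).mul_left γ
  rw [Kernel.integral_comp (M.integrable_policyQ π _)] at h
  simp only [← M.value_eq_integral_policyQ π] at h
  rw [← h.tsum_eq, policyQ, (M.summable_policyQ π _).tsum_eq_zero_add]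
  congr 1
  · simp [rewardAt]
  · refine tsum_congr fun t => ?_
    rw [pow_succ', mul_assoc]
    rfl

lemma integral_id_prod_policy (s : State d) (f : State d × A → ℝ) (hf : Measurable f) :
    ∫ z, f z ∂((Kernel.id ×ₖ π.1) s) = ∑ a, (π.1 s).real {a} * f (s, a) := by
  rw [Kernel.prod_apply, Kernel.id_apply, Measure.dirac_prod,
    integral_map (by fun_prop) hf.aestronglyMeasurable, integral_fintype .of_finite]
  simp

lemma sum_policy_eq_one (s : State d) : ∑ a, (π.1 s).real {a} = 1 := by
  rw [sum_measureReal_singleton]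
  simp

/-! ### The Bellman optimality equation -/

section Optimal

variable [Nonempty A]

lemma bddAbove_value (s : State d) : BddAbove (Set.range fun π : Policy d A => M.value π s) :=
  ⟨Rmax / (1 - γ), by rintro _ ⟨π, rfl⟩; exact (M.value_mem_Icc π s).2⟩

lemma value_le_optValue (s : State d) : M.value π s ≤ M.optValue s :=
  le_ciSup (M.bddAbove_value s) π

lemma nonempty_policy (d : ℕ) (A : Type*) [Fintype A] [MeasurableSpace A]
    [DiscreteMeasurableSpace A] [Nonempty A] : Nonempty (Policy d A) := by
  obtain ⟨π, -⟩ := exists_policy (d := d) (A := A) (p := fun _ _ => (Fintype.card A : ℝ)⁻¹)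
    (fun _ => measurable_const) (fun _ _ => by positivity) (fun _ => by simp)
  exact ⟨π⟩

lemma optValue_mem_Icc (s : State d) : M.optValue s ∈ Set.Icc 0 (Rmax / (1 - γ)) := by
  obtain ⟨π⟩ := nonempty_policy d A
  exact ⟨(M.value_mem_Icc π s).1.trans (M.value_le_optValue π s),
    ciSup_le fun π => (M.value_mem_Icc π s).2⟩

variable {M}

lemma integrable_optValue (hV : Measurable M.optValue) (μ : Measure (State d))
    [IsProbabilityMeasure μ] : Integrable M.optValue μ :=
  integrable_of_measurable_of_mem_Icc hV M.optValue_mem_Icc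

lemma measurable_optQ (hV : Measurable M.optValue) (a : A) : Measurable fun s => M.optQ s a := by
  have h : Measurable fun z => ∫ s', M.optValue s' ∂(M.trans z) :=
    hV.stronglyMeasurable.integral_kernel.measurable
  exact (M.measurable_reward a).add ((h.comp (measurable_id.prodMk measurable_const)).const_mul γ)

lemma optQ_mem_Icc (hV : Measurable M.optValue) (s : State d) (a : A) :
    M.optQ s a ∈ Set.Icc 0 (Rmax / (1 - γ)) := by
  have h0 := M.discount_pos
  have h1 := M.discount_lt_one
  have hI := integral_mem_Icc (μ := M.trans (s, a)) hV M.optValue_mem_Icc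
  refine ⟨add_nonneg (M.reward_nonneg s a) (mul_nonneg h0.le hI.1), ?_⟩
  calc M.optQ s a ≤ Rmax + γ * (Rmax / (1 - γ)) :=
        add_le_add (M.reward_le s a) (mul_le_mul_of_nonneg_left hI.2 h0.le)
    _ = Rmax / (1 - γ) := by
        have : 1 - γ ≠ 0 := by linarith
        field_simp
        ring

lemma optQ_le_ciSup (s : State d) (a : A) : M.optQ s a ≤ ⨆ b, M.optQ s b :=
  le_ciSup (f := M.optQ s) (Set.finite_range _).bddAbove a

lemma optActions_nonempty (s : State d) : (M.optActions s).Nonempty := by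
  obtain ⟨a, ha⟩ := Finite.exists_max (M.optQ s)
  exact ⟨a, ha⟩

lemma optQ_eq_ciSup {s : State d} {a : A} (ha : a ∈ M.optActions s) :
    M.optQ s a = ⨆ b, M.optQ s b :=
  le_antisymm (optQ_le_ciSup s a) (ciSup_le ha)

lemma optPolicy_nonneg (s : State d) (a : A) : 0 ≤ M.optPolicy s a := by
  unfold optPolicy
  split_ifs <;> positivity

lemma ncard_optActions (s : State d) [DecidablePred (· ∈ M.optActions s)] :
    ((M.optActions s).ncard : ℝ) = ∑ a, if a ∈ M.optActions s then 1 else 0 := by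
  rw [Finset.sum_boole, Set.ncard_eq_toFinset_card', Set.toFinset_card,
    Fintype.card_subtype]

lemma sum_optPolicy (s : State d) : ∑ a, M.optPolicy s a = 1 := by
  classical
  have h : ((M.optActions s).ncard : ℝ) ≠ 0 := by
    exact_mod_cast ((Set.ncard_pos (Set.toFinite _)).2 (optActions_nonempty s)).ne'
  calc ∑ a, M.optPolicy s a
      = ∑ a, (if a ∈ M.optActions s then 1 else 0) * ((M.optActions s).ncard : ℝ)⁻¹ := by
        refine Finset.sum_congr rfl fun a _ => ?_
        unfold optPolicy
        split_ifs <;> simp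
    _ = 1 := by rw [← Finset.sum_mul, ← ncard_optActions, mul_inv_cancel₀ h]

/-- Optimality of an action is finitely many measurable inequalities between `Q`-values. This admits
`π^*` as a competitor in the supremum that defines `V^*`. -/
lemma measurable_optPolicy (hV : Measurable M.optValue) (a : A) :
    Measurable fun s => M.optPolicy s a := by
  classical
  have hs : ∀ a, MeasurableSet {s | a ∈ M.optActions s} := fun a => by
    have : {s | a ∈ M.optActions s} = ⋂ b, {s | M.optQ s b ≤ M.optQ s a} := by
      ext s
      simp [optActions]
    rw [this]
    exact MeasurableSet.iInter fun b =>
      measurableSet_le (measurable_optQ hV b) (measurable_optQ hV a)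
  have hc : (fun s => M.optPolicy s a) = fun s => if a ∈ M.optActions s then
      (∑ b, if b ∈ M.optActions s then (1 : ℝ) else 0)⁻¹ else 0 := by
    funext s
    unfold optPolicy
    rw [ncard_optActions]
  rw [hc]
  refine Measurable.ite (hs a) ?_ measurable_const
  exact (Finset.measurable_fun_sum _ fun b _ =>
    Measurable.ite (hs b) measurable_const measurable_const).inv

/-- `V^π` is a `π`-average of `Q^π`, and `V^π ≤ V^*` inside the one-step formula gives `Q^π ≤ Q^*`.
-/
lemma value_le_ciSup_optQ (hV : Measurable M.optValue) (s : State d) :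
    M.value π s ≤ ⨆ a, M.optQ s a := by
  rw [value_eq_integral_policyQ, integral_id_prod_policy _ _ _ (M.measurable_policyQ π)]
  calc ∑ a, (π.1 s).real {a} * M.policyQ π (s, a)
      ≤ ∑ a, (π.1 s).real {a} * ⨆ a, M.optQ s a := by
        refine Finset.sum_le_sum fun a _ => mul_le_mul_of_nonneg_left ?_ measureReal_nonneg
        refine le_trans ?_ (optQ_le_ciSup s a)
        rw [policyQ_eq, optQ]
        have := M.discount_pos
        gcongr
        · exact integrable_of_measurable_of_mem_Icc (M.measurable_value π) (M.value_mem_Icc π)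
        · exact integrable_optValue hV _
        · exact fun s => M.value_le_optValue π s
    _ = _ := by rw [← Finset.sum_mul, sum_policy_eq_one, one_mul]

/-- The `Q`-function of the policy `π^*` dominates `Q^*`. -/
lemma optQ_le_policyQ (hV : Measurable M.optValue)
    (hπ : ∀ s a, (π.1 s).real {a} = M.optPolicy s a) (s : State d) (a : A) :
    M.optQ s a ≤ M.policyQ π (s, a) := by
  have h0 := M.discount_pos
  have h1 := M.discount_lt_one
  have hc : 0 ≤ Rmax / (1 - γ) := ((M.policyQ_mem_Icc π (s, a)).1).trans
    (M.policyQ_mem_Icc π (s, a)).2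
  -- the difference is contracted by the discount factor
  have key : ∀ m : ℝ, (∀ s a, M.optQ s a - M.policyQ π (s, a) ≤ m) →
      ∀ s a, M.optQ s a - M.policyQ π (s, a) ≤ γ * m := by
    intro m hm s a
    have hv : ∀ s', M.optValue s' ≤ M.value π s' + m := by
      intro s'
      refine (ciSup_le fun π' => value_le_ciSup_optQ π' hV s').trans ?_
      rw [value_eq_integral_policyQ, integral_id_prod_policy _ _ _ (M.measurable_policyQ π)]
      -- `π^*` charges only maximizers of `Q^*`, so averaging over it attains the maximum.
      have e1 : ⨆ a, M.optQ s' a = ∑ a, (π.1 s').real {a} * M.optQ s' a := by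
        calc ⨆ a, M.optQ s' a = ∑ b, (π.1 s').real {b} * ⨆ a, M.optQ s' a := by
              rw [← Finset.sum_mul, sum_policy_eq_one, one_mul]
          _ = _ := by
            refine Finset.sum_congr rfl fun b _ => ?_
            by_cases hb : b ∈ M.optActions s'
            · rw [optQ_eq_ciSup hb]
            · simp [hπ, optPolicy, hb]
      have e2 : m = ∑ a, (π.1 s').real {a} * m := by
        rw [← Finset.sum_mul, sum_policy_eq_one, one_mul]
      rw [e1]
      conv_rhs => rw [e2]
      rw [← Finset.sum_add_distrib]
      refine Finset.sum_le_sum fun b _ => ?_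
      rw [← mul_add]
      exact mul_le_mul_of_nonneg_left (by linarith [hm s' b]) measureReal_nonneg
    have hi := integrable_of_measurable_of_mem_Icc (μ := M.trans (s, a))
      (M.measurable_value π) (M.value_mem_Icc π)
    have := integral_mono (integrable_optValue hV (M.trans (s, a)))
      (hi.add (integrable_const m)) hv
    simp only [Pi.add_apply] at this
    rw [integral_add hi (integrable_const m)] at this
    simp only [integral_const, probReal_univ, one_smul] at this
    rw [policyQ_eq, optQ]
    nlinarith
  have pow : ∀ n : ℕ, ∀ s a, M.optQ s a - M.policyQ π (s, a) ≤ γ ^ n * (Rmax / (1 - γ)) := by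
    intro n
    induction n with
    | zero =>
      intro s a
      rw [pow_zero, one_mul]
      linarith [(M.policyQ_mem_Icc π (s, a)).1, (optQ_mem_Icc hV s a).2]
    | succ n ih =>
      intro s a
      rw [pow_succ', mul_assoc]
      exact key _ ih s a
  have hlim : Tendsto (fun n : ℕ => γ ^ n * (Rmax / (1 - γ))) atTop (𝓝 (0 * (Rmax / (1 - γ)))) :=
    (tendsto_pow_atTop_nhds_zero_of_lt_one h0.le h1).mul_const _
  rw [zero_mul] at hlim
  linarith [ge_of_tendsto' hlim fun n => pow n s a]

/-- The Bellman optimality equation. -/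
theorem optValue_eq_ciSup_optQ (hV : Measurable M.optValue) (s : State d) :
    M.optValue s = ⨆ a, M.optQ s a := by
  have := nonempty_policy d A
  refine le_antisymm (ciSup_le fun π => value_le_ciSup_optQ π hV s) ?_
  obtain ⟨π, hπ⟩ := exists_policy (measurable_optPolicy hV) optPolicy_nonneg sum_optPolicy
  refine le_trans ?_ (M.value_le_optValue π s)
  rw [value_eq_integral_policyQ, integral_id_prod_policy _ _ _ (M.measurable_policyQ π)]
  calc ⨆ a, M.optQ s a = ∑ b, (π.1 s).real {b} * ⨆ a, M.optQ s a := by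
        rw [← Finset.sum_mul, sum_policy_eq_one, one_mul]
    _ ≤ _ := by
      refine Finset.sum_le_sum fun b _ => ?_
      by_cases hb : b ∈ M.optActions s
      · rw [← optQ_eq_ciSup hb]
        exact mul_le_mul_of_nonneg_left (optQ_le_policyQ π hV hπ s b) measureReal_nonneg
      · simp [hπ, optPolicy, hb]

/-- `V^*` is a supremum over a possibly uncountable family of policies; its measurability is drawn
from the Lipschitz hypothesis. -/
lemma LipschitzValue.measurable {ζ : ℝ} (h : M.LipschitzValue ζ) : Measurable M.optValue := by
  have : LipschitzWith (Real.toNNReal ζ) M.optValue := by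
    refine LipschitzWith.of_dist_le_mul fun x y => ?_
    rw [Real.dist_eq, dist_eq_norm]
    exact (h x y).trans (mul_le_mul_of_nonneg_right (Real.le_coe_toNNReal ζ) (norm_nonneg _))
  exact this.continuous.measurable

end Optimal

end MDP

/-! ### Boltzmann distributions -/

section Boltzmann

variable {A : Type*} [Fintype A] (τ : ℝ) (q : A → ℝ)

lemma boltzmann_nonneg (a : A) : 0 ≤ boltzmann τ q a := by
  unfold boltzmann; positivity

lemma sum_exp_pos [Nonempty A] : 0 < ∑ b, Real.exp (q b / τ) :=
  Finset.sum_pos (fun _ _ => Real.exp_pos _) Finset.univ_nonempty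

lemma sum_boltzmann [Nonempty A] : ∑ a, boltzmann τ q a = 1 := by
  unfold boltzmann
  rw [← Finset.sum_div, div_self (sum_exp_pos τ q).ne']

lemma boltzmann_le_one [Nonempty A] (a : A) : boltzmann τ q a ≤ 1 := by
  rw [← sum_boltzmann τ q]
  exact Finset.single_le_sum (fun b _ => boltzmann_nonneg τ q b) (Finset.mem_univ a)

lemma measurable_boltzmann {Ω : Type*} [MeasurableSpace Ω] {q : Ω → A → ℝ}
    (hq : ∀ a, Measurable fun ω => q ω a) (a : A) : Measurable fun ω => boltzmann τ (q ω) a := by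
  unfold boltzmann
  exact ((hq a).div_const τ).exp.div
    (Finset.measurable_fun_sum _ fun b _ => ((hq b).div_const τ).exp)

end Boltzmann

lemma countable_grid (d : ℕ) (ε : ℝ) : (grid d ε).Countable := by
  have : grid d ε ⊆ Set.range fun k : Fin d → ℤ => WithLp.toLp 2 fun i => (k i : ℝ) * ε := by
    intro g hg
    choose k hk using hg
    refine ⟨k, ?_⟩
    ext i
    simp [hk]
  exact (Set.countable_range _).mono this

/-! ### Measurability of the oracle and existence of its policy -/

section Samples

variable {d : ℕ} {A : Type*} [Fintype A] [MeasurableSpace A] [DiscreteMeasurableSpace A]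
  {γ Rmax : ℝ} (M : MDP d A γ Rmax) {C : ℕ} {S : State d → State d}

instance : IsProbabilityMeasure (M.samplesLaw C) := by
  unfold MDP.samplesLaw; infer_instance

/-- A sample field indexed by uncountably many states cannot simply be evaluated at a random state.
Since `S` has countable range, measurability at each fixed grid point suffices. -/
lemma measurable_iSup_oracleQ_comp (hS : Measurable S) (hc : (Set.range S).Countable) {n : ℕ}
    (h : ∀ x b, Measurable fun ω : State d × A × Fin C → State d => M.oracleQ S ω n x b)
    {Ω : Type*} [MeasurableSpace Ω] {f : Ω → State d × A × Fin C → State d} {g : Ω → State d}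
    (hf : Measurable f) (hg : Measurable g) :
    Measurable fun p => ⨆ b, M.oracleQ S (f p) n (S (g p)) b := by
  have := hc.to_subtype
  have hm : Measurable fun z : Set.range S × (State d × A × Fin C → State d) =>
      ⨆ b, M.oracleQ S z.2 n z.1 b :=
    measurable_from_prod_countable_right fun x => Measurable.iSup fun b => h x b
  have hp : Measurable fun p => ((⟨S (g p), Set.mem_range_self _⟩ : Set.range S), f p) :=
    (hS.comp hg).subtype_mk.prodMk hf
  exact hm.comp hp

lemma measurable_oracleQ (hS : Measurable S) (hc : (Set.range S).Countable) (n : ℕ) (x : State d)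
    (a : A) : Measurable fun ω : State d × A × Fin C → State d => M.oracleQ S ω n x a := by
  induction n generalizing x a with
  | zero => exact measurable_const
  | succ n ih =>
    simp only [MDP.oracleQ]
    refine measurable_const.add (measurable_const.mul (measurable_const.mul ?_))
    exact Finset.measurable_fun_sum _ fun i _ =>
      measurable_iSup_oracleQ_comp M hS hc ih measurable_id (measurable_pi_apply _)

/-- The oracle reads the samples only at the root and on the range of `S`. -/
lemma oracleQ_congr {ω ω' : State d × A × Fin C → State d} (n : ℕ) (x : State d) (a : A)
    (h : ∀ y ∈ insert x (Set.range S), ∀ k, ω (y, k) = ω' (y, k)) :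
    M.oracleQ S ω n x a = M.oracleQ S ω' n x a := by
  induction n generalizing x a with
  | zero => rfl
  | succ n ih =>
    simp only [MDP.oracleQ]
    congr 3
    refine Finset.sum_congr rfl fun i _ => iSup_congr fun b => ?_
    rw [h x (Set.mem_insert _ _)]
    refine ih _ _ fun y hy k => h y ?_ k
    rw [Set.insert_eq_of_mem (Set.mem_range_self _)] at hy
    exact Set.mem_insert_of_mem _ hy

open Classical in
/-- Replace the samples at the state `s` by `y`. -/
def resample (s : State d) (y : A × Fin C → State d) (ω : State d × A × Fin C → State d) :
    State d × A × Fin C → State d :=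
  fun j => if j.1 = s then y j.2 else ω j

lemma measurable_resample (s : State d) :
    Measurable fun p : (A × Fin C → State d) × (State d × A × Fin C → State d) =>
      resample s p.1 p.2 := by
  refine measurable_pi_lambda _ fun j => ?_
  unfold resample
  split_ifs <;> fun_prop

/-- The law of the samples at a single state. -/
def rootLaw (C : ℕ) : Kernel (State d) (A × Fin C → State d) where
  toFun s := Measure.infinitePi fun k : A × Fin C => M.trans (s, k.1)
  measurable' := by
    refine Measurable.measure_of_isPiSystem_of_isProbabilityMeasure generateFrom_pi.symm
      isPiSystem_pi ?_
    rintro _ ⟨t, ht, rfl⟩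
    simp only [Measure.infinitePi_eq_pi, Measure.pi_pi]
    refine Finset.measurable_fun_prod _ fun k _ => ?_
    exact (Kernel.measurable_coe M.trans (ht k trivial)).comp
      (measurable_id.prodMk measurable_const)

lemma rootLaw_apply (s : State d) :
    rootLaw M C s = Measure.infinitePi fun k : A × Fin C => M.trans (s, k.1) := rfl

instance : IsMarkovKernel (rootLaw M C) :=
  ⟨fun s => by rw [rootLaw_apply]; infer_instance⟩

/-- Swapping in an independent copy of the block at `s` leaves a product law unchanged: on finite
cylinders the product splits into the coordinates at `s` and the others. -/
lemma map_resample (s : State d) :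
    ((rootLaw M C s).prod (M.samplesLaw C)).map (fun p => resample s p.1 p.2) =
      M.samplesLaw C := by
  classical
  refine Measure.eq_infinitePi _ fun F t ht => ?_
  have hpre : (fun p : (A × Fin C → State d) × (State d × A × Fin C → State d) =>
      resample s p.1 p.2) ⁻¹' (Set.pi F t) =
      (Set.pi ((F.filter fun j => j.1 = s).image Prod.snd : Finset _) fun k => t (s, k)) ×ˢ
        (Set.pi (F.filter fun j => ¬ j.1 = s : Finset _) t) := by
    ext ⟨y, ω⟩
    simp only [Set.mem_preimage, Set.mem_pi, Set.mem_prod, Finset.coe_image, Finset.coe_filter,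
      Set.mem_image, Set.mem_ofPred_eq, Finset.mem_coe, resample]
    constructor
    · intro h
      refine ⟨?_, fun j hj => by simpa [hj.2] using h j hj.1⟩
      rintro k ⟨j, ⟨hj, rfl⟩, rfl⟩
      simpa using h j hj
    · rintro ⟨h1, h2⟩ j hj
      by_cases hs : j.1 = s
      · subst hs
        simpa using h1 j.2 ⟨j, ⟨hj, rfl⟩, rfl⟩
      · simpa [hs] using h2 j ⟨hj, hs⟩
  rw [Measure.map_apply (measurable_resample s)
    (MeasurableSet.pi F.countable_toSet fun j _ => ht j), hpre, Measure.prod_prod, rootLaw_apply,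
    MDP.samplesLaw, Measure.infinitePi_pi _ fun k _ => ht _, Measure.infinitePi_pi _ fun k _ => ht _,
    ← Finset.prod_filter_mul_prod_filter_not F (fun j => j.1 = s)]
  congr 1
  rw [Finset.prod_image]
  · refine Finset.prod_congr rfl fun j hj => ?_
    obtain ⟨-, rfl⟩ := Finset.mem_filter.1 hj
    rfl
  · intro j hj k hk hjk
    have h1 := (Finset.mem_filter.1 hj).2
    have h2 := (Finset.mem_filter.1 hk).2
    exact Prod.ext (h1.trans h2.symm) hjk

variable [Nonempty A]

lemma integrable_boltzmann_oracleQ (hS : Measurable S) (hc : (Set.range S).Countable) (τ : ℝ)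
    (H : ℕ) (s : State d) (a : A) :
    Integrable (fun ω => boltzmann τ (M.oracleQ S ω H s) a) (M.samplesLaw C) :=
  integrable_of_measurable_of_mem_Icc
    (measurable_boltzmann τ (fun b => measurable_oracleQ M hS hc H s b) a)
    fun _ => ⟨boltzmann_nonneg _ _ _, boltzmann_le_one _ _ _⟩

/-- The samples at the root are replaced by a fresh block whose law depends measurably on `s`.
Outside the range of `S` the tree never returns to its root, so the rest of the field can be
integrated independently of `s`, and the integral is a kernel integral. The range of `S` is
countable, so what happens there does not affect measurability. -/
lemma measurable_integral_boltzmann (hS : Measurable S) (hc : (Set.range S).Countable) (τ : ℝ)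
    (H : ℕ) (a : A) :
    Measurable fun s => ∫ ω, boltzmann τ (M.oracleQ S ω H s) a ∂(M.samplesLaw C) := by
  cases H with
  | zero =>
    have : ∀ s : State d, ∀ ω : State d × A × Fin C → State d,
        M.oracleQ S ω 0 s = fun _ => 0 := fun s ω => rfl
    simp only [this]
    exact measurable_const
  | succ n =>
    let q : State d × (A × Fin C → State d) × (State d × A × Fin C → State d) → A → ℝ :=
      fun z a => M.reward z.1 a +
        γ * ((1 / (C : ℝ)) * ∑ i, ⨆ b, M.oracleQ S z.2.2 n (S (z.2.1 (a, i))) b)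
    have hq : ∀ a, Measurable fun z => q z a := by
      intro a
      refine ((M.measurable_reward a).comp measurable_fst).add
        (measurable_const.mul (measurable_const.mul ?_))
      refine Finset.measurable_fun_sum _ fun i _ => ?_
      exact measurable_iSup_oracleQ_comp M hS hc (fun x b => measurable_oracleQ M hS hc n x b)
        (measurable_snd.comp measurable_snd)
        ((measurable_pi_apply _).comp (measurable_fst.comp measurable_snd))
    have hm : Measurable fun s => ∫ p, boltzmann τ (q (s, p)) a
        ∂((rootLaw M C ×ₖ Kernel.const _ (M.samplesLaw C)) s) :=
      (StronglyMeasurable.integral_kernel_prod_right'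
        (measurable_boltzmann τ hq a).stronglyMeasurable).measurable
    refine hm.measurable_of_countable_ne (hc.mono fun s hs => ?_)
    by_contra hsr
    refine hs ?_
    rw [Kernel.prod_apply, Kernel.const_apply]
    conv_rhs => rw [← map_resample M s]
    rw [integral_map (measurable_resample s).aemeasurable
      (measurable_boltzmann τ (fun b => measurable_oracleQ M hS hc _ s b) a).aestronglyMeasurable]
    refine integral_congr_ae (ae_of_all _ fun p => ?_)
    have : q (s, p) = M.oracleQ S (resample s p.1 p.2) (n + 1) s := by
      funext b
      simp only [q, MDP.oracleQ, resample, if_true]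
      congr! 6 with i _ c
      refine oracleQ_congr M n _ _ fun y hy k => ?_
      rw [Set.insert_eq_of_mem (Set.mem_range_self _)] at hy
      -- Below the root only grid points are read, and `s` is not one of them.
      have hys : y ≠ s := by
        rintro rfl
        exact hsr hy
      simp [resample, hys]
    simp only [this]

lemma exists_isOraclePolicy (hS : Measurable S) (hc : (Set.range S).Countable) (τ : ℝ) (H : ℕ) :
    ∃ π, M.IsOraclePolicy τ H C S π := by
  refine exists_policy (measurable_integral_boltzmann M hS hc τ H)
    (fun s a => integral_nonneg fun ω => boltzmann_nonneg _ _ _) fun s => ?_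
  rw [← integral_finsetSum _ fun a _ => integrable_boltzmann_oracleQ M hS hc τ H s a]
  simp [sum_boltzmann]

end Samples

/-! ### Rounding to the grid and counting grid points -/

section Grid

variable {d : ℕ} {ε : ℝ} {S : State d → State d}

lemma IsNearestGridMap.countable_range (h : IsNearestGridMap ε S) : (Set.range S).Countable :=
  (countable_grid d ε).mono (Set.range_subset_iff.2 h.mem_grid)

lemma IsNearestGridMap.norm_sub_le (h : IsNearestGridMap ε S) (hε : 0 < ε) (x : State d) :
    ‖x - S x‖ ≤ ε * Real.sqrt d / 2 := by
  -- Coordinatewise rounding is a competitor at distance at most `ε / 2` in each coordinate.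
  let g : State d := WithLp.toLp 2 fun i => (round (x i / ε) : ℝ) * ε
  refine (h.dist_le x g fun i => ⟨_, rfl⟩).trans ?_
  rw [EuclideanSpace.norm_eq]
  have hi : ∀ i, ‖(x - g) i‖ ^ 2 ≤ (ε / 2) ^ 2 := by
    intro i
    have h1 : (x - g) i = (x i / ε - round (x i / ε)) * ε := by
      simp only [g, PiLp.sub_apply]
      field_simp
    rw [h1, norm_mul, Real.norm_eq_abs, Real.norm_eq_abs, abs_of_pos hε]
    have := abs_sub_round (x i / ε)
    gcongr
    nlinarith
  calc Real.sqrt (∑ i, ‖(x - g) i‖ ^ 2) ≤ Real.sqrt (∑ _ : Fin d, (ε / 2) ^ 2) :=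
        Real.sqrt_le_sqrt (Finset.sum_le_sum fun i _ => hi i)
    _ = ε * Real.sqrt d / 2 := by
      rw [Finset.sum_const, Finset.card_univ, Fintype.card_fin, nsmul_eq_mul,
        Real.sqrt_mul (Nat.cast_nonneg d), Real.sqrt_sq (by positivity)]
      ring

/-- Each coordinate of a grid point near `s` takes at most `2r / ε + 1` values. The extra `1` counts
the root, which need not lie on the grid. -/
lemma exists_finset_grid (hε : 0 < ε) (s : State d) {r : ℝ} (hr : 0 ≤ r) :
    ∃ G : Finset (State d), (∀ x, (x = s ∨ x ∈ grid d ε) → ‖x - s‖ ≤ r → x ∈ G) ∧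
      (G.card : ℝ) ≤ 1 + (2 * r / ε + 1) ^ d := by
  classical
  let I : Fin d → Finset ℤ := fun i => Finset.Icc ⌈(s i - r) / ε⌉ ⌊(s i + r) / ε⌋
  let f : (Fin d → ℤ) → State d := fun k => WithLp.toLp 2 fun i => (k i : ℝ) * ε
  refine ⟨insert s ((Fintype.piFinset I).image f), ?_, ?_⟩
  · rintro x (rfl | hx) hxr
    · exact Finset.mem_insert_self _ _
    · refine Finset.mem_insert_of_mem (Finset.mem_image.2 ?_)
      choose k hk using hx
      refine ⟨k, Fintype.mem_piFinset.2 fun i => ?_, ?_⟩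
      · have h1 : |x i - s i| ≤ r := (PiLp.norm_apply_le (x - s) i).trans hxr
        rw [hk i, abs_le] at h1
        rw [Finset.mem_Icc, Int.ceil_le, Int.le_floor, div_le_iff₀ hε, le_div_iff₀ hε]
        constructor <;> linarith
      · ext i
        simp [f, hk]
  · have h1 : ((insert s ((Fintype.piFinset I).image f)).card : ℝ) ≤
        1 + ∏ i, ((I i).card : ℝ) := by
      have := (Finset.card_insert_le s ((Fintype.piFinset I).image f)).trans
        (Nat.add_le_add_right (Finset.card_image_le (f := f)) 1)
      rw [Fintype.card_piFinset] at this
      have h2 : ((insert s ((Fintype.piFinset I).image f)).card : ℝ) ≤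
        ((∏ i, (I i).card + 1 : ℕ) : ℝ) := by exact_mod_cast this
      push_cast at h2
      linarith
    refine h1.trans ?_
    have h3 : ∀ i, ((I i).card : ℝ) ≤ 2 * r / ε + 1 := by
      intro i
      simp only [I, Int.card_Icc]
      have hle : (s i - r) / ε ≤ (s i + r) / ε := by gcongr; linarith
      have hnn : 0 ≤ 2 * r / ε := by positivity
      have hb : (((⌊(s i + r) / ε⌋ + 1 - ⌈(s i - r) / ε⌉).toNat : ℤ) : ℝ) ≤ 2 * r / ε + 1 := by
        rw [Int.toNat_eq_max]
        push_cast
        refine max_le ?_ (by linarith)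
        have e1 := Int.floor_le ((s i + r) / ε)
        have e2 := Int.le_ceil ((s i - r) / ε)
        have e3 : 2 * r / ε = (s i + r) / ε - (s i - r) / ε := by ring
        linarith
      exact_mod_cast hb
    calc 1 + ∏ i, ((I i).card : ℝ) ≤ 1 + ∏ _i : Fin d, (2 * r / ε + 1) := by
          gcongr with i
          exact h3 i
      _ = _ := by simp

end Grid

/-! ### The states visited by the sampling tree -/

section Tree

variable {d : ℕ} {A : Type*} [Fintype A] {C : ℕ} {S : State d → State d}
  {ω : State d × A × Fin C → State d} {s : State d} {β ν' : ℝ} {H : ℕ} {G : Finset (State d)}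

lemma norm_snap_sub_le (hS : ∀ x, ‖x - S x‖ ≤ β) {x y : State d} (hxy : ‖y - x‖ ≤ ν') {k : ℕ}
    (hx : ‖x - s‖ ≤ k * (ν' + β)) : ‖S y - s‖ ≤ (k + 1 : ℕ) * (ν' + β) := by
  have h1 : S y - s = -(y - S y) + (y - x) + (x - s) := by abel
  rw [h1]
  refine (norm_add₃_le).trans ?_
  rw [norm_neg]
  push_cast
  linarith [hS y]

lemma treeLevel_subset (hS : ∀ x, ‖x - S x‖ ≤ β) (hν : 0 ≤ ν') (hβ : 0 ≤ β)
    (hG : ∀ x, (x = s ∨ x ∈ Set.range S) → ‖x - s‖ ≤ H * (ν' + β) → x ∈ G)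
    (hstep : ∀ x ∈ G, ∀ k, ‖ω (x, k) - x‖ ≤ ν') {h : ℕ} (hh : h ≤ H) :
    ∀ x ∈ treeLevel S ω s h, (x = s ∨ x ∈ Set.range S) ∧ ‖x - s‖ ≤ h * (ν' + β) := by
  induction h with
  | zero =>
    intro x hx
    rw [treeLevel, Finset.mem_singleton] at hx
    simp [hx]
  | succ h ih =>
    intro x hx
    rw [treeLevel, Finset.mem_image] at hx
    obtain ⟨⟨y, k⟩, hj, rfl⟩ := hx
    obtain ⟨hy1, hy2⟩ := ih (by omega) y (Finset.mem_product.1 hj).1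
    refine ⟨Or.inr (Set.mem_range_self _), norm_snap_sub_le hS (hstep y (hG y hy1 ?_) k) hy2⟩
    refine hy2.trans ?_
    have : (h : ℝ) ≤ H := by exact_mod_cast (by omega : h ≤ H)
    gcongr

lemma sampleCount_le (hS : ∀ x, ‖x - S x‖ ≤ β) (hν : 0 ≤ ν') (hβ : 0 ≤ β)
    (hG : ∀ x, (x = s ∨ x ∈ Set.range S) → ‖x - s‖ ≤ H * (ν' + β) → x ∈ G)
    (hstep : ∀ x ∈ G, ∀ k, ‖ω (x, k) - x‖ ≤ ν') :
    sampleCount S ω H s ≤ G.card * (Fintype.card A * C) := by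
  unfold sampleCount
  refine Nat.mul_le_mul_right _ (Finset.card_le_card ?_)
  refine Finset.biUnion_subset.2 fun h hh x hx => ?_
  have hh' := (Finset.mem_range.1 hh).le
  obtain ⟨h1, h2⟩ := treeLevel_subset hS hν hβ hG hstep hh' x hx
  refine hG x h1 (h2.trans ?_)
  have : (h : ℝ) ≤ H := by exact_mod_cast hh'
  gcongr

end Tree

/-! ### Error propagation through the backups -/

section Accuracy

variable {d : ℕ} {A : Type*} [Fintype A] [MeasurableSpace A] [DiscreteMeasurableSpace A]
  [Nonempty A] {γ Rmax : ℝ} {M : MDP d A γ Rmax} {C : ℕ} {S : State d → State d}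
  {ω : State d × A × Fin C → State d} {s : State d} {β ν' ζ η : ℝ} {H : ℕ} {G : Finset (State d)}

lemma abs_ciSup_sub_ciSup_le {f g : A → ℝ} {e : ℝ} (h : ∀ a, |f a - g a| ≤ e) :
    |(⨆ a, f a) - ⨆ a, g a| ≤ e := by
  have hf := (Set.finite_range f).bddAbove
  have hg := (Set.finite_range g).bddAbove
  rw [abs_le]
  constructor
  · have : ⨆ a, g a ≤ (⨆ a, f a) + e := ciSup_le fun a => by
      linarith [(abs_le.1 (h a)).1, le_ciSup hf a]
    linarith
  · have : ⨆ a, f a ≤ (⨆ a, g a) + e := ciSup_le fun a => by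
      linarith [(abs_le.1 (h a)).2, le_ciSup hg a]
    linarith

/-- One backup propagates the error of the values of the children. -/
lemma abs_oracleQ_succ_sub_optQ_le (hC : 0 < C) (hζ : 0 ≤ ζ) (hL : M.LipschitzValue ζ)
    (hS : ∀ x, ‖x - S x‖ ≤ β) {n : ℕ} {x : State d} {a : A} {e : ℝ}
    (hmean : |(1 / (C : ℝ)) * ∑ i, M.optValue (ω (x, a, i)) -
      ∫ y, M.optValue y ∂(M.trans (x, a))| ≤ η)
    (he : ∀ i, |(⨆ b, M.oracleQ S ω n (S (ω (x, a, i))) b) - M.optValue (S (ω (x, a, i)))| ≤ e) :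
    |M.oracleQ S ω (n + 1) x a - M.optQ x a| ≤ γ * (e + (ζ * β + η)) := by
  have hγ := M.discount_pos
  have hC' : (0 : ℝ) < C := by exact_mod_cast hC
  set v : Fin C → ℝ := fun i => ⨆ b, M.oracleQ S ω n (S (ω (x, a, i))) b
  have h1 : ∀ i, |v i - M.optValue (ω (x, a, i))| ≤ e + ζ * β := by
    intro i
    have := hL (S (ω (x, a, i))) (ω (x, a, i))
    have h2 : ‖S (ω (x, a, i)) - ω (x, a, i)‖ ≤ β := by
      rw [norm_sub_rev]
      exact hS _
    calc |v i - M.optValue (ω (x, a, i))|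
        ≤ |v i - M.optValue (S (ω (x, a, i)))| +
          |M.optValue (S (ω (x, a, i))) - M.optValue (ω (x, a, i))| := abs_sub_le _ _ _
      _ ≤ e + ζ * β := add_le_add (he i) (this.trans (mul_le_mul_of_nonneg_left h2 hζ))
  have h3 : |(1 / (C : ℝ)) * ∑ i, v i - (1 / (C : ℝ)) * ∑ i, M.optValue (ω (x, a, i))|
      ≤ e + ζ * β := by
    rw [← mul_sub, ← Finset.sum_sub_distrib, abs_mul, abs_of_pos (by positivity)]
    calc 1 / (C : ℝ) * |∑ i, (v i - M.optValue (ω (x, a, i)))|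
        ≤ 1 / (C : ℝ) * ∑ _i : Fin C, (e + ζ * β) := by
          gcongr
          exact (Finset.abs_sum_le_sum_abs _ _).trans (Finset.sum_le_sum fun i _ => h1 i)
      _ = e + ζ * β := by
          simp only [Finset.sum_const, Finset.card_univ, Fintype.card_fin, nsmul_eq_mul]
          field_simp
  have h4 : M.oracleQ S ω (n + 1) x a - M.optQ x a = γ * ((1 / (C : ℝ)) * ∑ i, v i -
      ∫ y, M.optValue y ∂(M.trans (x, a))) := by
    simp only [MDP.oracleQ, MDP.optQ, v]
    ring
  rw [h4, abs_mul, abs_of_pos hγ]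
  refine mul_le_mul_of_nonneg_left ?_ hγ.le
  calc _ ≤ _ := abs_sub_le _ ((1 / (C : ℝ)) * ∑ i, M.optValue (ω (x, a, i))) _
    _ ≤ (e + ζ * β) + η := add_le_add h3 hmean
    _ = _ := by ring

/-- Purely deterministic: all randomness is in `hstep` and `hmean`. The last term is the fixed point
of `e ↦ γ (e + σ)` with `σ = ζβ + η`; the first is the error of the zero leaves, discounted `H`
times. -/
lemma abs_oracleQ_sub_optQ_le (hC : 0 < C) (hζ : 0 ≤ ζ) (hL : M.LipschitzValue ζ)
    (hS : ∀ x, ‖x - S x‖ ≤ β) (hν : 0 ≤ ν') (hβ : 0 ≤ β) (hη : 0 ≤ η)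
    (hG : ∀ x, (x = s ∨ x ∈ Set.range S) → ‖x - s‖ ≤ H * (ν' + β) → x ∈ G)
    (hstep : ∀ x ∈ G, ∀ k, ‖ω (x, k) - x‖ ≤ ν')
    (hmean : ∀ x ∈ G, ∀ a, |(1 / (C : ℝ)) * ∑ i, M.optValue (ω (x, a, i)) -
      ∫ y, M.optValue y ∂(M.trans (x, a))| ≤ η) (hH : 0 < H) (a : A) :
    |M.oracleQ S ω H s a - M.optQ s a| ≤
      γ ^ H * (Rmax / (1 - γ)) + γ * (ζ * β + η) / (1 - γ) := by
  have hγ := M.discount_pos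
  have hγ1 : 0 < 1 - γ := by linarith [M.discount_lt_one]
  set σ := ζ * β + η
  have hσ : 0 ≤ σ := by positivity
  have hB := MDP.optValue_eq_ciSup_optQ hL.measurable
  have hin : ∀ (k : ℕ) (x : State d), k ≤ H → (x = s ∨ x ∈ Set.range S) →
      ‖x - s‖ ≤ k * (ν' + β) → x ∈ G := by
    intro k x hk hx hxs
    refine hG x hx (hxs.trans ?_)
    have : (k : ℝ) ≤ H := by exact_mod_cast hk
    gcongr
  have hrec : ∀ n : ℕ, γ * (γ ^ n * (Rmax / (1 - γ)) + γ * σ / (1 - γ) + σ) =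
      γ ^ (n + 1) * (Rmax / (1 - γ)) + γ * σ / (1 - γ) := by
    intro n
    field_simp
    ring
  -- Here `n` counts levels above the leaves and `k` steps from the root; `n + k ≤ H` keeps every
  -- point that is sampled inside `G`.
  have key : ∀ n k x, n + k ≤ H → (x = s ∨ x ∈ Set.range S) → ‖x - s‖ ≤ k * (ν' + β) →
      |(⨆ b, M.oracleQ S ω n x b) - M.optValue x| ≤
        γ ^ n * (Rmax / (1 - γ)) + γ * σ / (1 - γ) := by
    intro n
    induction n with
    | zero =>
      intro k x _ _ _
      simp only [MDP.oracleQ, ciSup_const, zero_sub, abs_neg, pow_zero, one_mul]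
      rw [abs_of_nonneg (M.optValue_mem_Icc x).1]
      have : 0 ≤ γ * σ / (1 - γ) := by positivity
      linarith [(M.optValue_mem_Icc x).2]
    | succ n ih =>
      intro k x hk hx hxs
      have hxG := hin k x (by omega) hx hxs
      rw [hB, ← hrec]
      refine abs_ciSup_sub_ciSup_le fun a => ?_
      refine abs_oracleQ_succ_sub_optQ_le hC hζ hL hS (hmean x hxG a) fun i => ?_
      exact ih (k + 1) _ (by omega) (Or.inr (Set.mem_range_self _))
        (norm_snap_sub_le hS (hstep x hxG _) hxs)
  obtain ⟨n, rfl⟩ : ∃ n, H = n + 1 := ⟨H - 1, by omega⟩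
  have hs0 : ‖s - s‖ ≤ (0 : ℕ) * (ν' + β) := by simp
  have hsG := hin 0 s (by omega) (Or.inl rfl) hs0
  rw [← hrec]
  refine abs_oracleQ_succ_sub_optQ_le hC hζ hL hS (hmean s hsG a) fun i => ?_
  exact key n (0 + 1) _ (by omega) (Or.inr (Set.mem_range_self _))
    (norm_snap_sub_le hS (hstep s hsG _) hs0)

end Accuracy

/-! ### Concentration of the sample means -/

section Concentration

variable {d : ℕ} {A : Type*} [Fintype A] [MeasurableSpace A] [DiscreteMeasurableSpace A]
  {γ Rmax : ℝ} (M : MDP d A γ Rmax) {C : ℕ}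

/-- Finiteness of `G` matters: an almost sure bound for all states at once would involve uncountably
many null sets. -/
lemma ae_samplesLaw_norm_sub_le {ν' : ℝ}
    (h : ∀ s a, ∀ᵐ s' ∂(M.trans (s, a)), ‖s' - s‖ ≤ ν') (G : Finset (State d)) :
    ∀ᵐ ω ∂(M.samplesLaw C), ∀ x ∈ G, ∀ k, ‖ω (x, k) - x‖ ≤ ν' := by
  rw [Filter.eventually_all_finset]
  intro x _
  rw [ae_all_iff]
  rintro ⟨a, i⟩
  have hp := measurePreserving_eval_infinitePi
    (fun j : State d × A × Fin C => M.trans (j.1, j.2.1)) (x, a, i)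
  exact hp.quasiMeasurePreserving.ae (h x a)

lemma samplesLaw_real_sum_ge_le (x : State d) (a : A) {f : State d → ℝ} (hf : Measurable f)
    {l u : ℝ} (hlu : ∀ y, f y ∈ Set.Icc l u) {η : ℝ} (hη : 0 ≤ η) (hC : 0 < C) :
    (M.samplesLaw C).real {ω | η ≤ (1 / (C : ℝ)) * ∑ i, f (ω (x, a, i)) -
      ∫ y, f y ∂(M.trans (x, a))} ≤ Real.exp (-(2 * C * η ^ 2 / (u - l) ^ 2)) := by
  have hC' : (0 : ℝ) < C := by exact_mod_cast hC
  have hp : ∀ i : Fin C, MeasurePreserving (fun ω : State d × A × Fin C → State d => ω (x, a, i))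
      (M.samplesLaw C) (M.trans (x, a)) := fun i =>
    measurePreserving_eval_infinitePi
      (fun j : State d × A × Fin C => M.trans (j.1, j.2.1)) (x, a, i)
  have hint : ∀ i : Fin C, ∫ ω, f (ω (x, a, i)) ∂(M.samplesLaw C) =
      ∫ y, f y ∂(M.trans (x, a)) := fun i => by
    rw [← (hp i).map_eq, integral_map (hp i).measurable.aemeasurable hf.aestronglyMeasurable]
  have hind : iIndepFun (fun (i : Fin C) (ω : State d × A × Fin C → State d) =>
      f (ω (x, a, i)) - ∫ y, f y ∂(M.trans (x, a))) (M.samplesLaw C) := by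
    have := iIndepFun_infinitePi (P := fun j : State d × A × Fin C => M.trans (j.1, j.2.1))
      (X := fun j y => f y - ∫ y, f y ∂(M.trans (j.1, j.2.1))) (fun j => hf.sub_const _)
    exact this.precomp (g := fun i : Fin C => (x, a, i)) fun i j hij => by simpa using hij
  have hsub : ∀ i ∈ (Finset.univ : Finset (Fin C)),
      HasSubgaussianMGF (fun ω : State d × A × Fin C → State d =>
      f (ω (x, a, i)) - ∫ y, f y ∂(M.trans (x, a))) ((‖u - l‖₊ / 2) ^ 2) (M.samplesLaw C) := by
    intro i _
    have := hasSubgaussianMGF_of_mem_Icc (μ := M.samplesLaw C)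
      (X := fun ω => f (ω (x, a, i))) (a := l) (b := u)
      (hf.comp (hp i).measurable).aemeasurable (ae_of_all _ fun ω => hlu _)
    rwa [hint i] at this
  have h := HasSubgaussianMGF.measure_sum_ge_le_of_iIndepFun hind hsub (ε := C * η) (by positivity)
  convert h using 1
  · congr 1
    ext ω
    simp only [Set.mem_ofPred_eq, Finset.sum_sub_distrib, Finset.sum_const, Finset.card_univ,
      Fintype.card_fin, nsmul_eq_mul]
    rw [← mul_le_mul_iff_right₀ hC', mul_sub]
    field_simp
  · congr 1
    simp only [Finset.sum_const, Finset.card_univ, Fintype.card_fin, nsmul_eq_mul]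
    push_cast
    rw [Real.norm_eq_abs, div_pow, sq_abs]
    -- If `u = l`, both exponents vanish, since division by zero gives zero.
    by_cases h0 : u - l = 0
    · simp [h0]
    · field_simp

/-- **Hoeffding's inequality** for the mean of the samples of a state-action pair. -/
lemma samplesLaw_real_abs_mean_sub_ge_le (x : State d) (a : A) {f : State d → ℝ}
    (hf : Measurable f) {c : ℝ} (hc : ∀ y, f y ∈ Set.Icc 0 c) {η : ℝ} (hη : 0 ≤ η) (hC : 0 < C) :
    (M.samplesLaw C).real {ω | η ≤ |(1 / (C : ℝ)) * ∑ i, f (ω (x, a, i)) -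
      ∫ y, f y ∂(M.trans (x, a))|} ≤ 2 * Real.exp (-(2 * C * η ^ 2 / c ^ 2)) := by
  have h1 := samplesLaw_real_sum_ge_le M (C := C) x a hf hc hη hC
  have h2 := samplesLaw_real_sum_ge_le M (C := C) x a (f := fun y => -f y) hf.neg (l := -c) (u := 0)
    (fun y => ⟨neg_le_neg (hc y).2, neg_nonpos.2 (hc y).1⟩) hη hC
  simp only [Finset.sum_neg_distrib, integral_neg] at h2
  rw [sub_zero] at h1
  rw [zero_sub, neg_neg] at h2
  calc _ ≤ (M.samplesLaw C).real _ := measureReal_mono (fun ω hω => ?_)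
    _ ≤ _ := (measureReal_union_le _ _).trans (add_le_add h1 h2)
    _ = _ := by ring
  rcases le_abs.1 (Set.mem_ofPred_eq ▸ hω) with h | h
  · exact Or.inl h
  · refine Or.inr ?_
    change η ≤ _
    linarith

/-- A union bound over a set fixed in advance, so the random choice of the visited states plays no
role. -/
lemma samplesLaw_real_exists_le (G : Finset (State d)) {f : State d → ℝ}
    (hf : Measurable f) {c : ℝ} (hc : ∀ y, f y ∈ Set.Icc 0 c) {η : ℝ} (hη : 0 ≤ η) (hC : 0 < C) :
    (M.samplesLaw C).real {ω | ∃ x ∈ G, ∃ a, η ≤ |(1 / (C : ℝ)) * ∑ i, f (ω (x, a, i)) -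
      ∫ y, f y ∂(M.trans (x, a))|} ≤
      2 * Fintype.card A * G.card * Real.exp (-(2 * C * η ^ 2 / c ^ 2)) := by
  have : {ω : State d × A × Fin C → State d | ∃ x ∈ G, ∃ a,
      η ≤ |(1 / (C : ℝ)) * ∑ i, f (ω (x, a, i)) - ∫ y, f y ∂(M.trans (x, a))|} =
      ⋃ j ∈ G ×ˢ (Finset.univ : Finset A), {ω | η ≤ |(1 / (C : ℝ)) * ∑ i, f (ω (j.1, j.2, i)) -
      ∫ y, f y ∂(M.trans (j.1, j.2))|} := by
    ext ω
    simp
  rw [this]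
  refine (measureReal_biUnion_finset_le _ _).trans ?_
  refine (Finset.sum_le_sum fun j _ =>
    samplesLaw_real_abs_mean_sub_ge_le M j.1 j.2 hf hc hη hC).trans_eq ?_
  rw [Finset.sum_const, Finset.card_product, Finset.card_univ, nsmul_eq_mul]
  push_cast
  ring

end Concentration

/-! ### Distance between the oracle policy and `π^*` -/

section Distance

variable {d : ℕ} {A : Type*} [Fintype A] [MeasurableSpace A] [DiscreteMeasurableSpace A]
  [Nonempty A] {γ Rmax : ℝ} {M : MDP d A γ Rmax}

/-- Both weights sum to one, so only upper bounds on the Boltzmann weights are needed later. -/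
lemma sum_abs_sub_eq {p r : A → ℝ} (hp : ∑ a, p a = 1) (hr : ∑ a, r a = 1) :
    ∑ a, |p a - r a| = 2 * ∑ a, max (p a - r a) 0 := by
  have h : ∀ a, |p a - r a| = 2 * max (p a - r a) 0 - (p a - r a) := by
    intro a
    rcases le_total 0 (p a - r a) with h | h
    · rw [abs_of_nonneg h, max_eq_left h]; ring
    · rw [abs_of_nonpos h, max_eq_right h]; ring
  simp only [h, Finset.sum_sub_distrib, ← Finset.mul_sum, hp, hr]
  ring

/-- The Boltzmann distribution of an approximate `Q`-function is close to the uniform distribution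
on the optimal actions. -/
lemma sum_abs_boltzmann_sub_optPolicy_le {τ Δ e : ℝ} (hτ : 0 < τ) {s : State d} {q : A → ℝ}
    (hq : ∀ a, |q a - M.optQ s a| ≤ e) (hΔ : (Δ : EReal) ≤ M.minGap) :
    ∑ a, |boltzmann τ q a - M.optPolicy s a| ≤
      2 * ((Real.exp (2 * e / τ) - 1) +
        Fintype.card A * (Real.exp (2 * e / τ) * Real.exp (-(Δ / τ)))) := by
  classical
  have he : 0 ≤ e := (abs_nonneg _).trans (hq (Classical.arbitrary A))
  have hx : 1 ≤ Real.exp (2 * e / τ) := Real.one_le_exp (by positivity)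
  set m := ⨆ b, M.optQ s b
  set N : ℝ := ((M.optActions s).ncard : ℝ)
  have hN : 1 ≤ N := by
    have : 1 ≤ (M.optActions s).ncard :=
      (Set.ncard_pos (Set.toFinite _)).2 (MDP.optActions_nonempty (M := M) s)
    exact Nat.one_le_cast.2 this
  set y := Real.exp ((m - e) / τ)
  have hy : 0 < y := Real.exp_pos _
  -- Only the `N` optimal actions are kept in the normalizer; each contributes at least `y`.
  have hZ : N * y ≤ ∑ b, Real.exp (q b / τ) := by
    calc N * y = ∑ a, (if a ∈ M.optActions s then 1 else 0) * y := by
          rw [← Finset.sum_mul, ← MDP.ncard_optActions]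
      _ ≤ _ := by
          refine Finset.sum_le_sum fun a _ => ?_
          split_ifs with ha
          · rw [one_mul]
            refine Real.exp_le_exp.2 (div_le_div_of_nonneg_right ?_ hτ.le)
            have h1 : M.optQ s a = m := MDP.optQ_eq_ciSup ha
            linarith [(abs_le.1 (hq a)).1]
          · rw [zero_mul]; positivity
  have hb : ∀ a, boltzmann τ q a ≤ Real.exp (q a / τ) / (N * y) := fun a => by
    unfold boltzmann
    have : 0 < N * y := by positivity
    gcongr
  have key : ∀ a, max (boltzmann τ q a - M.optPolicy s a) 0 ≤
      (Real.exp (2 * e / τ) - 1) * M.optPolicy s a +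
        Real.exp (2 * e / τ) * Real.exp (-(Δ / τ)) := by
    intro a
    have hp0 := MDP.optPolicy_nonneg (M := M) s a
    refine max_le ?_ (by have : 0 ≤ Real.exp (2 * e / τ) - 1 := by linarith
                         positivity)
    by_cases ha : a ∈ M.optActions s
    · have h1 : M.optQ s a = m := MDP.optQ_eq_ciSup ha
      have h2 : M.optPolicy s a = N⁻¹ := by simp [MDP.optPolicy, ha, N]
      have h3 : Real.exp (q a / τ) ≤ Real.exp (2 * e / τ) * y := by
        rw [← Real.exp_add]
        refine Real.exp_le_exp.2 ?_
        rw [← add_div]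
        refine div_le_div_of_nonneg_right ?_ hτ.le
        linarith [(abs_le.1 (hq a)).2]
      have h4 : boltzmann τ q a ≤ Real.exp (2 * e / τ) * N⁻¹ := by
        refine (hb a).trans ?_
        rw [div_le_iff₀ (by positivity)]
        calc _ ≤ _ := h3
          _ = _ := by field_simp
      have h5 : 0 ≤ Real.exp (2 * e / τ) * Real.exp (-(Δ / τ)) := by positivity
      rw [h2]
      linarith
    · have h2 : M.optPolicy s a = 0 := by simp [MDP.optPolicy, ha]
      have h1 : Δ ≤ m - M.optQ s a := by
        have : (Δ : EReal) ≤ ((m - M.optQ s a : ℝ) : EReal) :=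
          hΔ.trans ((iInf_le _ s).trans (iInf₂_le a ha))
        exact_mod_cast this
      have h3 : Real.exp (q a / τ) ≤ Real.exp (2 * e / τ) * Real.exp (-(Δ / τ)) * y := by
        rw [← Real.exp_add, ← Real.exp_add]
        refine Real.exp_le_exp.2 ?_
        rw [← neg_div, ← add_div, ← add_div]
        refine div_le_div_of_nonneg_right ?_ hτ.le
        linarith [(abs_le.1 (hq a)).2]
      have h4 : boltzmann τ q a ≤ Real.exp (2 * e / τ) * Real.exp (-(Δ / τ)) := by
        refine (hb a).trans ?_
        rw [div_le_iff₀ (by positivity)]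
        refine h3.trans ?_
        refine mul_le_mul_of_nonneg_left ?_ (by positivity)
        nlinarith
      rw [h2]
      linarith
  rw [sum_abs_sub_eq (sum_boltzmann τ q) (MDP.sum_optPolicy s)]
  refine mul_le_mul_of_nonneg_left ((Finset.sum_le_sum fun a _ => key a).trans_eq ?_) two_pos.le
  rw [Finset.sum_add_distrib, ← Finset.mul_sum, MDP.sum_optPolicy, mul_one]
  simp

lemma sum_abs_sub_le_two {p r : A → ℝ} (hp : ∑ a, p a = 1) (hr : ∑ a, r a = 1)
    (hp0 : ∀ a, 0 ≤ p a) (hr0 : ∀ a, 0 ≤ r a) : ∑ a, |p a - r a| ≤ 2 := by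
  calc ∑ a, |p a - r a| ≤ ∑ a, (p a + r a) := Finset.sum_le_sum fun a _ => by
        rw [abs_le]; constructor <;> linarith [hp0 a, hr0 a]
    _ = 2 := by rw [Finset.sum_add_distrib, hp, hr]; norm_num

/-- If the Boltzmann distribution is close to `π^*` outside of an event of small probability, then
so is the oracle policy. -/
lemma sum_abs_oraclePolicy_sub_le {C H : ℕ} {S : State d → State d} {τ g b : ℝ}
    (hS : Measurable S) (hc : (Set.range S).Countable) {π : Policy d A}
    (hπ : M.IsOraclePolicy τ H C S π) (s : State d)
    (B : Set (State d × A × Fin C → State d)) (hg : 0 ≤ g)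
    (hB : (M.samplesLaw C).real B ≤ b)
    (hgood : ∀ᵐ ω ∂(M.samplesLaw C), ω ∉ B →
      ∑ a, |boltzmann τ (M.oracleQ S ω H s) a - M.optPolicy s a| ≤ g) :
    ∑ a, |(π.1 s).real {a} - M.optPolicy s a| ≤ g + 2 * b := by
  have hi := fun a => integrable_boltzmann_oracleQ M (C := C) hS hc τ H s a
  have hi' : ∀ a, Integrable (fun ω => |boltzmann τ (M.oracleQ S ω H s) a - M.optPolicy s a|)
      (M.samplesLaw C) := fun a => ((hi a).sub (integrable_const _)).abs
  have h1 : ∀ a, |(π.1 s).real {a} - M.optPolicy s a| ≤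
      ∫ ω, |boltzmann τ (M.oracleQ S ω H s) a - M.optPolicy s a| ∂(M.samplesLaw C) := by
    intro a
    have : (π.1 s).real {a} - M.optPolicy s a =
        ∫ ω, (boltzmann τ (M.oracleQ S ω H s) a - M.optPolicy s a) ∂(M.samplesLaw C) := by
      rw [integral_sub (hi a) (integrable_const _), hπ]
      simp
    rw [this]
    exact abs_integral_le_integral_abs
  -- `B` is not assumed measurable, so it is replaced by a measurable hull of the same measure.
  set T := toMeasurable (M.samplesLaw C) B
  have hT : MeasurableSet T := measurableSet_toMeasurable _ _
  have hTB : (M.samplesLaw C).real T = (M.samplesLaw C).real B := by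
    simp only [measureReal_def, T, measure_toMeasurable]
  calc ∑ a, |(π.1 s).real {a} - M.optPolicy s a|
      ≤ ∑ a, ∫ ω, |boltzmann τ (M.oracleQ S ω H s) a - M.optPolicy s a| ∂(M.samplesLaw C) :=
        Finset.sum_le_sum fun a _ => h1 a
    _ = ∫ ω, ∑ a, |boltzmann τ (M.oracleQ S ω H s) a - M.optPolicy s a| ∂(M.samplesLaw C) :=
        (integral_finsetSum _ fun a _ => hi' a).symm
    _ ≤ ∫ ω, (g + T.indicator (fun _ => 2) ω) ∂(M.samplesLaw C) := by
        refine integral_mono_ae (integrable_finsetSum _ fun a _ => hi' a)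
          ((integrable_const _).add ((integrable_const _).indicator hT)) ?_
        filter_upwards [hgood] with ω hω
        by_cases h : ω ∈ T
        · rw [Set.indicator_of_mem h]
          linarith [sum_abs_sub_le_two (sum_boltzmann τ (M.oracleQ S ω H s))
            (MDP.sum_optPolicy (M := M) s) (boltzmann_nonneg _ _) (MDP.optPolicy_nonneg s)]
        · rw [Set.indicator_of_notMem h, add_zero]
          exact hω fun hB => h (subset_toMeasurable _ _ hB)
    _ = g + 2 * (M.samplesLaw C).real B := by
        rw [integral_add (integrable_const _) ((integrable_const _).indicator hT),
          integral_indicator_const _ hT, hTB]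
        simp [mul_comm]
    _ ≤ g + 2 * b := by linarith

end Distance

/-! ### The mesh, the depth and the size of the visited set -/

section Parameters

variable {d : ℕ} {γ Rmax ζ δ : ℝ}

lemma mesh_pos (hd : 1 ≤ d) (hγ0 : 0 < γ) (hγ1 : γ < 1) (hR : 0 < Rmax) (hζ : 0 < ζ)
    (hδ : 0 < δ) : 0 < mesh d γ Rmax ζ δ := by
  have : 0 < 1 - γ := by linarith
  have : (0 : ℝ) < d := by exact_mod_cast hd
  unfold mesh
  positivity

lemma mesh_mul_sqrt (hd : 1 ≤ d) (hγ0 : 0 < γ) (hγ1 : γ < 1) (hζ : 0 < ζ) :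
    mesh d γ Rmax ζ δ * Real.sqrt d / 2 = δ * (Rmax / (1 - γ)) * (1 - γ) / (4 * ζ * γ) := by
  have : 1 - γ ≠ 0 := by linarith
  have hd' : (0 : ℝ) < d := by exact_mod_cast hd
  have : 0 < Real.sqrt d := by positivity
  unfold mesh
  field_simp
  norm_num

lemma pow_depth_le (hγ0 : 0 < γ) (hγ1 : γ < 1) (hδ : 0 < δ) : γ ^ depth γ δ ≤ δ := by
  rw [← Real.rpow_natCast]
  calc γ ^ (depth γ δ : ℝ) ≤ γ ^ (Real.logb γ δ) :=
        Real.rpow_le_rpow_of_exponent_ge hγ0 hγ1.le (Nat.le_ceil _)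
    _ = δ := Real.rpow_logb hγ0 hγ1.ne hδ

lemma depth_pos (hγ0 : 0 < γ) (hγ1 : γ < 1) (hδ : 0 < δ) (hδ1 : δ < 1) : 0 < depth γ δ :=
  Nat.ceil_pos.2 (Real.logb_pos_of_base_lt_one hγ0 hγ1 hδ hδ1)

/-- The number of states that the oracle can visit. -/
lemma exists_finset_visited (hd : 1 ≤ d) {ε ν' : ℝ} (hε : 0 < ε) (hν : 0 < ν') {H : ℕ}
    (hH : 0 < H) {S : State d → State d} (hS : IsNearestGridMap ε S) (s : State d) :
    ∃ G : Finset (State d),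
      (∀ x, (x = s ∨ x ∈ Set.range S) → ‖x - s‖ ≤ H * (ν' + ε * Real.sqrt d / 2) → x ∈ G) ∧
      (G.card : ℝ) ≤ (H * max 1 (1 / ε) * (2 * ν' + Real.sqrt d + 2)) ^ d := by
  have hH' : (1 : ℝ) ≤ H := by exact_mod_cast hH
  obtain ⟨G, hG, hcard⟩ := exists_finset_grid hε s
    (r := H * (ν' + ε * Real.sqrt d / 2)) (by positivity)
  refine ⟨G, fun x hx => hG x (hx.imp_right ?_), hcard.trans ?_⟩
  · rintro ⟨y, rfl⟩
    exact hS.mem_grid y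
  · set y := 2 * (H * (ν' + ε * Real.sqrt d / 2)) / ε
    have hy : 0 ≤ y := by positivity
    calc 1 + (y + 1) ^ d = 1 ^ d + (y + 1) ^ d := by rw [one_pow]
      -- Superadditivity of the `d`-th power absorbs the root into the base; this needs `d ≠ 0`.
      _ ≤ (1 + (y + 1)) ^ d := pow_add_pow_le zero_le_one (by positivity) (by omega)
      _ ≤ _ := by
        refine pow_le_pow_left₀ (by positivity) ?_ d
        have e1 : y = H * (1 / ε) * (2 * ν') + H * Real.sqrt d := by
          simp only [y]
          field_simp
        have e2 : H * (1 / ε) * (2 * ν') ≤ H * max 1 (1 / ε) * (2 * ν') := by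
          gcongr
          exact le_max_right _ _
        have e3 : (H : ℝ) ≤ H * max 1 (1 / ε) := le_mul_of_one_le_right (by positivity)
          (le_max_left _ _)
        have e4 : H * Real.sqrt d ≤ H * max 1 (1 / ε) * Real.sqrt d := by gcongr
        nlinarith

end Parameters

/-! ### The number of samples in the union bound -/

section Width

variable {d : ℕ} {γ Rmax ν' ζ δ : ℝ} {cA : ℕ}

/-- The factor by which the number of samples has to exceed `widthOrder`. -/
def widthConst (d : ℕ) (ν' : ℝ) : ℝ := 8 * (1 + d * Real.log (2 * ν' + Real.sqrt d + 2))

lemma widthConst_pos (hν : 0 < ν') : 0 < widthConst d ν' := by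
  have : 0 ≤ Real.log (2 * ν' + Real.sqrt d + 2) :=
    Real.log_nonneg (by linarith [Real.sqrt_nonneg (d : ℝ)])
  unfold widthConst
  positivity

lemma one_le_log_card_div (hA : 1 ≤ cA) (hδ : 0 < δ) (hδ1 : δ ≤ 1 / 2) :
    1 ≤ Real.log (2 * cA / δ) := by
  have hA' : (1 : ℝ) ≤ cA := by exact_mod_cast hA
  have h : Real.exp 1 ≤ 2 * cA / δ := by
    rw [le_div_iff₀ hδ]
    nlinarith [Real.exp_one_lt_d9]
  rw [Real.le_log_iff_exp_le (by positivity)]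
  exact h

lemma widthOrder_pos (hγ0 : 0 < γ) (hγ1 : γ < 1) (hA : 1 ≤ cA) (hδ : 0 < δ) (hδ1 : δ ≤ 1 / 2) :
    0 < widthOrder d γ Rmax ζ cA δ := by
  have h1 := one_le_log_card_div hA hδ hδ1
  have h2 := Real.log_natCast_nonneg (depth γ δ)
  have h3 : 0 < 1 - γ := by linarith
  have h4 := le_max_left 0 (Real.log (1 / mesh d γ Rmax ζ δ))
  unfold widthOrder
  have : 0 < Real.log (2 * cA / δ) := by linarith
  positivity

/-- The number of samples makes the union bound over the visited states at most `δ`. -/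
lemma union_bound_le (hγ0 : 0 < γ) (hγ1 : γ < 1) (hR : 0 < Rmax) (hν : 0 < ν')
    (hε : 0 < mesh d γ Rmax ζ δ) (hA : 1 ≤ cA) (hδ : 0 < δ) (hδ1 : δ ≤ 1 / 2) {C : ℕ}
    (hC : widthConst d ν' * widthOrder d γ Rmax ζ cA δ ≤ C) {N : ℝ}
    (hN : N ≤ (depth γ δ * max 1 (1 / mesh d γ Rmax ζ δ) * (2 * ν' + Real.sqrt d + 2)) ^ d) :
    2 * cA * N * Real.exp (-(2 * C * (δ * (Rmax / (1 - γ)) * (1 - γ) / (4 * γ)) ^ 2 /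
      (Rmax / (1 - γ)) ^ 2)) ≤ δ := by
  have h1 := one_le_log_card_div hA hδ hδ1
  have h2 := Real.log_natCast_nonneg (depth γ δ)
  have h3 : 0 < 1 - γ := by linarith
  have hA' : (0 : ℝ) < cA := by exact_mod_cast hA
  set ε := mesh d γ Rmax ζ δ
  set b := 2 * ν' + Real.sqrt d + 2
  have hb : 2 ≤ b := by linarith [Real.sqrt_nonneg (d : ℝ)]
  have hlb : 0 ≤ Real.log b := Real.log_nonneg (by linarith)
  have hH : (0 : ℝ) < depth γ δ := by
    exact_mod_cast depth_pos hγ0 hγ1 hδ (by linarith : δ < 1)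
  have hm : Real.log (max 1 (1 / ε)) = max 0 (Real.log (1 / ε)) := by
    rcases le_total (1 / ε) 1 with h | h
    · rw [max_eq_left h, Real.log_one, max_eq_left (Real.log_nonpos (by positivity) h)]
    · rw [max_eq_right h, max_eq_right (Real.log_nonneg h)]
  have hm0 : 0 ≤ Real.log (max 1 (1 / ε)) := Real.log_nonneg (le_max_left _ _)
  have hm1 : 0 < max 1 (1 / ε) := lt_of_lt_of_le one_pos (le_max_left _ _)
  set P := Real.log (2 * cA / δ) + d * Real.log (depth γ δ) + d * Real.log (max 1 (1 / ε))
  -- The `8` appearing here is cancelled by the factor `8` of `widthConst`.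
  have hexp : 2 * C * (δ * (Rmax / (1 - γ)) * (1 - γ) / (4 * γ)) ^ 2 / (Rmax / (1 - γ)) ^ 2 =
      C * (δ ^ 2 * (1 - γ) ^ 2 / (8 * γ ^ 2)) := by
    field_simp
    ring
  have hCP : (1 + d * Real.log b) * P ≤ C * (δ ^ 2 * (1 - γ) ^ 2 / (8 * γ ^ 2)) := by
    have := mul_le_mul_of_nonneg_right hC
      (by positivity : 0 ≤ δ ^ 2 * (1 - γ) ^ 2 / (8 * γ ^ 2))
    refine le_trans (le_of_eq ?_) this
    unfold widthConst widthOrder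
    rw [← hm]
    simp only [P, b, ε]
    field_simp
  -- `P ≥ 1`, which comes from `δ ≤ 1 / 2`, allows the constant `d log b` to be absorbed as a
  -- multiple of `P`.
  have hsum : Real.log (2 * cA / δ) + d * (Real.log (depth γ δ) + Real.log (max 1 (1 / ε)) +
      Real.log b) ≤ (1 + d * Real.log b) * P := by
    have e1 : 0 ≤ d * Real.log (depth γ δ) := by positivity
    have e2 : 0 ≤ d * Real.log (max 1 (1 / ε)) := by positivity
    have e3 : 0 ≤ d * Real.log b := by positivity
    have e4 : 1 ≤ P := by simp only [P]; linarith
    have e5 : d * Real.log b ≤ d * Real.log b * P := le_mul_of_one_le_right e3 e4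
    simp only [P] at e5 ⊢
    linarith
  have hprod : 2 * cA / δ * (depth γ δ * max 1 (1 / ε) * b) ^ d =
      Real.exp (Real.log (2 * cA / δ) + d * (Real.log (depth γ δ) +
        Real.log (max 1 (1 / ε)) + Real.log b)) := by
    rw [Real.exp_add, Real.exp_log (by positivity), Real.exp_nat_mul, Real.exp_add, Real.exp_add,
      Real.exp_log hH, Real.exp_log hm1, Real.exp_log (by linarith)]
  rw [hexp, Real.exp_neg, ← div_eq_mul_inv, div_le_iff₀ (Real.exp_pos _)]
  calc 2 * cA * N ≤ 2 * cA * (depth γ δ * max 1 (1 / ε) * b) ^ d := by gcongr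
    _ = δ * (2 * cA / δ * (depth γ δ * max 1 (1 / ε) * b) ^ d) := by field_simp
    _ ≤ _ := by
      rw [hprod]
      refine mul_le_mul_of_nonneg_left (Real.exp_le_exp.2 (hsum.trans hCP)) hδ.le

end Width

/-! ### The oracle policy is close to `π^*` -/

section Closeness

variable {d : ℕ} {A : Type*} [Fintype A] [MeasurableSpace A] [DiscreteMeasurableSpace A]
  [Nonempty A] {γ Rmax : ℝ} {M : MDP d A γ Rmax}

lemma sum_abs_oraclePolicy_sub_optPolicy_le (hd : 1 ≤ d) (hR : 0 < Rmax) {ν' ζ Δ τ δ : ℝ}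
    (hν : 0 < ν') (hζ : 0 < ζ) (hτ : 0 < τ) (hδ : δ = τ ^ 2) (hδ1 : δ ≤ 1 / 2)
    (hstep : ∀ s a, ∀ᵐ s' ∂(M.trans (s, a)), ‖s' - s‖ ≤ ν')
    (hL : M.LipschitzValue ζ) (hΔ : (Δ : EReal) ≤ M.minGap) {C : ℕ}
    (hC : widthConst d ν' * widthOrder d γ Rmax ζ (Fintype.card A) δ ≤ C)
    {S : State d → State d} (hS : IsNearestGridMap (mesh d γ Rmax ζ δ) S) {π : Policy d A}
    (hπ : M.IsOraclePolicy τ (depth γ δ) C S π) (s : State d) :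
    ∑ a, |(π.1 s).real {a} - M.optPolicy s a| ≤
      2 * ((Real.exp (3 * τ * (Rmax / (1 - γ))) - 1) + Fintype.card A *
        (Real.exp (3 * τ * (Rmax / (1 - γ))) * Real.exp (-(Δ / τ)))) + 2 * δ := by
  have hγ0 := M.discount_pos
  have hγ1 := M.discount_lt_one
  have hγ' : 0 < 1 - γ := by linarith
  have hδ0 : 0 < δ := by rw [hδ]; positivity
  have hε := mesh_pos hd hγ0 hγ1 hR hζ hδ0
  have hA : 1 ≤ Fintype.card A := Fintype.card_pos
  have hW := widthOrder_pos (d := d) (Rmax := Rmax) (ζ := ζ) hγ0 hγ1 hA hδ0 hδ1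
  have hC0 : 0 < C := by
    have : (0 : ℝ) < C := (mul_pos (widthConst_pos hν) hW).trans_le hC
    exact_mod_cast this
  have hH := depth_pos hγ0 hγ1 hδ0 (by linarith : δ < 1)
  obtain ⟨G, hG, hcard⟩ := exists_finset_visited hd hε hν hH hS s
  set V := Rmax / (1 - γ)
  have hV : 0 < V := by positivity
  -- This equals `ζ` times the rounding distance: rounding and sampling contribute equally, and
  -- together add `δV / 2` to the truncation error `δV`.
  set η := δ * V * (1 - γ) / (4 * γ)
  have hη : 0 ≤ η := by positivity
  have hB := samplesLaw_real_exists_le M (C := C) G hL.measurable M.optValue_mem_Icc hη hC0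
  have hbound := hB.trans (union_bound_le hγ0 hγ1 hR hν hε hA hδ0 hδ1 hC hcard)
  refine sum_abs_oraclePolicy_sub_le hS.measurable hS.countable_range hπ s _ ?_ hbound ?_
  · have : 0 ≤ Real.exp (3 * τ * V) - 1 := by
      linarith [Real.one_le_exp (by positivity : 0 ≤ 3 * τ * V)]
    positivity
  · filter_upwards [ae_samplesLaw_norm_sub_le M hstep G] with ω hω hωB
    have hmean : ∀ x ∈ G, ∀ a, |(1 / (C : ℝ)) * ∑ i, M.optValue (ω (x, a, i)) -
        ∫ y, M.optValue y ∂(M.trans (x, a))| ≤ η := by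
      intro x hx a
      by_contra! h
      exact hωB ⟨x, hx, a, h.le⟩
    have herr : ∀ a, |M.oracleQ S ω (depth γ δ) s a - M.optQ s a| ≤ 3 / 2 * δ * V := by
      intro a
      refine (abs_oracleQ_sub_optQ_le hC0 hζ.le hL (hS.norm_sub_le hε) hν.le (by positivity) hη
        hG hω hmean hH a).trans ?_
      have h1 : γ ^ depth γ δ * V ≤ δ * V :=
        mul_le_mul_of_nonneg_right (pow_depth_le hγ0 hγ1 hδ0) hV.le
      have h2 : γ * (ζ * (mesh d γ Rmax ζ δ * Real.sqrt d / 2) + η) / (1 - γ) = δ * V / 2 := by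
        rw [mesh_mul_sqrt hd hγ0 hγ1 hζ]
        simp only [η, V]
        field_simp
        norm_num
      change γ ^ depth γ δ * V + _ ≤ _
      rw [h2]
      linarith
    have hx : 2 * (3 / 2 * δ * V) / τ = 3 * τ * V := by
      rw [hδ]
      field_simp
    have := sum_abs_boltzmann_sub_optPolicy_le hτ herr hΔ
    rwa [hx] at this

end Closeness

/-! ### The role of the threshold `τ(α)` -/

section Temperature

lemma exp_le_one_add_two_mul {x : ℝ} (h0 : 0 ≤ x) (h1 : x ≤ 1 / 2) :
    Real.exp x ≤ 1 + 2 * x := by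
  have := Real.abs_exp_sub_one_sub_id_le (x := x) (by rw [abs_of_nonneg h0]; linarith)
  have h2 := (abs_le.1 this).2
  nlinarith

variable {γ Rmax ν Δ α τ : ℝ} {cA : ℕ}

/-- Temperatures below `τ(α)` keep the policy within `α / (2ν)` of `π^*`. -/
lemma policy_distance_le (hγ1 : γ < 1) (hR : 0 < Rmax) (hν : 0 < ν)
    (hα : 0 < α) (hαν : α ≤ ν) (hA : 1 ≤ cA) (hτ : 0 < τ) (hle : τ ≤ tauMax γ Rmax ν Δ cA α) :
    2 * ((Real.exp (3 * τ * (Rmax / (1 - γ))) - 1) + cA *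
        (Real.exp (3 * τ * (Rmax / (1 - γ))) * Real.exp (-(Δ / τ)))) + 2 * τ ^ 2 ≤
      α / (2 * ν) := by
  have hA' : (1 : ℝ) ≤ cA := by exact_mod_cast hA
  have hγ : 0 < 1 - γ := by linarith
  unfold tauMax at hle
  simp only [le_min_iff] at hle
  obtain ⟨⟨h1, h2⟩, h3, h4⟩ := hle
  set x := 3 * τ * (Rmax / (1 - γ))
  set u := α / ν
  have hu : 0 < u := by positivity
  have hx0 : 0 ≤ x := by positivity
  have hx1 : x ≤ 3 / 8 := by
    calc x ≤ 3 * ((1 - γ) / (8 * Rmax)) * (Rmax / (1 - γ)) := by simp only [x]; gcongr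
      _ = 3 / 8 := by field_simp
  have hx2 : x ≤ u / 16 := by
    calc x ≤ 3 * ((1 - γ) * α / (48 * Rmax * (cA : ℝ) ^ 2 * ν)) * (Rmax / (1 - γ)) := by
          simp only [x]; gcongr
      _ = u / 16 / (cA : ℝ) ^ 2 := by simp only [u]; field_simp; norm_num
      _ ≤ u / 16 := div_le_self (by positivity) (by nlinarith)
  have hsq : τ ^ 2 ≤ u / 24 := by
    have := Real.sq_sqrt (by positivity : 0 ≤ α / (24 * ν))
    calc τ ^ 2 ≤ Real.sqrt (α / (24 * ν)) ^ 2 := by gcongr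
      _ = u / 24 := by rw [this]; simp only [u]; field_simp
  have hlog : 0 < Real.log (24 * ν * cA / α) := by
    refine Real.log_pos ?_
    rw [lt_div_iff₀ hα]
    nlinarith
  have hgap : Real.exp (-(Δ / τ)) ≤ α / (24 * ν * cA) := by
    have h5 : Real.log (24 * ν * cA / α) ≤ Δ / τ := by
      rw [le_div_iff₀ hlog] at h4
      rw [le_div_iff₀ hτ]
      linarith
    rw [Real.exp_neg]
    have h6 : 24 * ν * cA / α ≤ Real.exp (Δ / τ) := by
      rwa [← Real.log_le_iff_le_exp (by positivity)]
    calc (Real.exp (Δ / τ))⁻¹ ≤ (24 * ν * cA / α)⁻¹ := inv_anti₀ (by positivity) h6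
      _ = _ := by rw [inv_div]
  have he := exp_le_one_add_two_mul hx0 (by linarith)
  have hnon : cA * (Real.exp x * Real.exp (-(Δ / τ))) ≤ u / 12 := by
    calc cA * (Real.exp x * Real.exp (-(Δ / τ))) ≤ cA * (2 * (α / (24 * ν * cA))) := by
          gcongr
          linarith
      _ = u / 12 := by simp only [u]; field_simp; norm_num
  -- The budget is exact: `exp x - 1 ≤ 2x ≤ u / 8`, so the total is at most `2 (u / 8 + u / 12) + u
  -- / 12 = u / 2`.
  have : α / (2 * ν) = u / 2 := by simp only [u]; field_simp
  rw [this]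
  linarith

lemma sq_le_of_le_tauMax (hν : 0 < ν) (hα : 0 < α) (hτ : 0 < τ)
    (hle : τ ≤ tauMax γ Rmax ν Δ cA α) : τ ^ 2 ≤ α / (24 * ν) := by
  have h1 : τ ≤ Real.sqrt (α / (24 * ν)) := hle.trans ((min_le_left _ _).trans (min_le_left _ _))
  rwa [Real.le_sqrt hτ.le (by positivity)] at h1

end Temperature

/-! ### Geometric drift for Markov chains -/

section GeometricDrift

variable {X : Type*} [MeasurableSpace X] {κ : Kernel X X} [IsMarkovKernel κ] {W : X → ℝ≥0∞}
  {ρ b : ℝ≥0∞}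

lemma lintegral_chainLaw_zero (x : X) {g : X → ℝ≥0∞} (hg : Measurable g) :
    ∫⁻ y, g (y 0) ∂chainLaw (Measure.dirac x) (fun _ => κ) = g x := by
  have h := map_eval_zero_chainLaw (μ := Measure.dirac x) (κ := fun _ => κ)
  rw [← lintegral_map hg (measurable_pi_apply 0), h, lintegral_dirac' _ hg]

lemma lintegral_chainLaw_le (hW : Measurable W) (h : ∀ x, ∫⁻ y, W y ∂(κ x) ≤ ρ * W x + b)
    (x : X) (n : ℕ) :
    ∫⁻ y, W (y n) ∂chainLaw (Measure.dirac x) (fun _ => κ) ≤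
      ρ ^ n * W x + b * ∑ k ∈ Finset.range n, ρ ^ k := by
  induction n with
  | zero => simp [lintegral_chainLaw_zero x hW]
  | succ n ih =>
    have h1 := lintegral_chainLaw_mul_succ (μ := Measure.dirac x) (κ := fun _ => κ) (n := n)
      (F := fun _ => 1) measurable_const hW
    simp only [one_mul] at h1
    rw [h1]
    calc _ ≤ ∫⁻ y, (ρ * W (y n) + b) ∂chainLaw (Measure.dirac x) (fun _ => κ) :=
          lintegral_mono fun y => h (y n)
      _ = ρ * ∫⁻ y, W (y n) ∂chainLaw (Measure.dirac x) (fun _ => κ) + b := by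
          rw [lintegral_add_right _ measurable_const,
            lintegral_const_mul _ (show Measurable fun y : ℕ → X => W (y n) from
              hW.comp (measurable_pi_apply n))]
          simp
      _ ≤ ρ * (ρ ^ n * W x + b * ∑ k ∈ Finset.range n, ρ ^ k) + b := by gcongr
      _ = _ := by
          rw [Finset.sum_range_succ', mul_add, mul_add, pow_zero, mul_one]
          simp only [pow_succ', ← Finset.mul_sum]
          ring

/-- Markov's inequality at level `w`; the contribution `ρ ^ n * W x` of the initial state dies out.
-/
lemma limsup_chainLaw_le (hW : Measurable W) (hρ : ρ < 1)
    (h : ∀ x, ∫⁻ y, W y ∂(κ x) ≤ ρ * W x + b) {x : X} (hx : W x ≠ ∞) {D : Set X} {w : ℝ≥0∞}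
    (hw0 : w ≠ 0) (hw : w ≠ ∞) (hD : ∀ y ∉ D, w ≤ W y) :
    limsup (fun n : ℕ => chainLaw (Measure.dirac x) (fun _ => κ) {y | y n ∉ D}) atTop ≤
      b * (1 - ρ)⁻¹ / w := by
  have hle : ∀ n : ℕ, chainLaw (Measure.dirac x) (fun _ => κ) {y | y n ∉ D} ≤
      (ρ ^ n * W x + b * (1 - ρ)⁻¹) / w := by
    intro n
    calc _ ≤ chainLaw (Measure.dirac x) (fun _ => κ) {y | w ≤ W (y n)} :=
          measure_mono fun y hy => hD _ hy
      _ ≤ (∫⁻ y, W (y n) ∂chainLaw (Measure.dirac x) (fun _ => κ)) / w :=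
          meas_ge_le_lintegral_div (hW.comp (measurable_pi_apply n)).aemeasurable hw0 hw
      _ ≤ _ := by
          refine ENNReal.div_le_div_right ((lintegral_chainLaw_le hW h x n).trans ?_) w
          rw [← ENNReal.tsum_geometric]
          gcongr
          exact ENNReal.sum_le_tsum _
  refine (limsup_le_limsup (Eventually.of_forall hle)).trans_eq (Tendsto.limsup_eq ?_)
  have h0 : Tendsto (fun n : ℕ => ρ ^ n * W x) atTop (𝓝 (0 * W x)) :=
    ENNReal.Tendsto.mul_const (ENNReal.tendsto_pow_atTop_nhds_zero_of_lt_one hρ) (Or.inr hx)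
  rw [zero_mul] at h0
  have h1 := ENNReal.Tendsto.div_const (h0.add_const (b * (1 - ρ)⁻¹)) (Or.inr hw0 : _ ∨ w ≠ 0)
  rwa [zero_add] at h1

/-- As long as `D` has not been hit, each step multiplies the mean of `W` by at most `ρ`. Since `W ≥
1`, the probability of avoiding `D` up to time `n` is at most `ρ ^ n * W x`, and these bounds are
summed. -/
lemma lintegral_hittingTime_le (hW : Measurable W) (h1 : ∀ x, 1 ≤ W x) {D : Set X}
    (hD : MeasurableSet D) (h : ∀ x ∉ D, ∫⁻ y, W y ∂(κ x) ≤ ρ * W x) (x : X) :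
    ∫⁻ y, hittingTime D y ∂chainLaw (Measure.dirac x) (fun _ => κ) ≤ W x * (1 - ρ)⁻¹ := by
  set P := chainLaw (Measure.dirac x) (fun _ => κ)
  have hE : ∀ n : ℕ, MeasurableSet {y : ℕ → X | ∀ k ≤ n, y k ∉ D} := fun n => by
    have : {y : ℕ → X | ∀ k ≤ n, y k ∉ D} = ⋂ k, ⋂ _ : k ≤ n, (fun y => y k) ⁻¹' Dᶜ := by
      ext y; simp
    rw [this]
    exact MeasurableSet.iInter fun k => MeasurableSet.iInter fun _ =>
      hD.compl.preimage (measurable_pi_apply k)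
  set I : ℕ → (ℕ → X) → ℝ≥0∞ := fun n => Set.indicator {y : ℕ → X | ∀ k ≤ n, y k ∉ D} 1
  have hI : ∀ n, Measurable (I n) := fun n => measurable_one.indicator (hE n)
  have hw : ∀ n, ∫⁻ y, I n y * W (y n) ∂P ≤ ρ ^ n * W x := by
    intro n
    induction n with
    | zero =>
      rw [pow_zero, one_mul, ← lintegral_chainLaw_zero (κ := κ) x hW]
      exact lintegral_mono fun y => mul_le_of_le_one_left zero_le
        (Set.indicator_le_self' (fun _ _ => zero_le) y)
    | succ n ih =>
      -- Avoiding `D` up to time `n` is an event of the past, so the Markov property applies; the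
      -- condition at time `n + 1` is dropped.
      let F : (Finset.Iic n → X) → ℝ≥0∞ := Set.indicator {y | ∀ i, y i ∉ D} 1
      have hF : Measurable F := by
        refine measurable_one.indicator ?_
        have : {y : Finset.Iic n → X | ∀ i, y i ∉ D} = ⋂ i, (fun y => y i) ⁻¹' Dᶜ := by
          ext y; simp
        rw [this]
        exact MeasurableSet.iInter fun i => hD.compl.preimage (measurable_pi_apply i)
      have hFI : ∀ y : ℕ → X, F (Preorder.frestrictLe n y) = I n y := by
        intro y
        by_cases hy : ∀ k ≤ n, y k ∉ D
        · have h1 : F (Preorder.frestrictLe n y) = 1 := Set.indicator_of_mem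
            (s := {y : Finset.Iic n → X | ∀ i, y i ∉ D})
            (fun i => hy i (Finset.mem_Iic.1 i.2)) _
          have h2 : I n y = 1 :=
            Set.indicator_of_mem (s := {y : ℕ → X | ∀ k ≤ n, y k ∉ D}) hy _
          rw [h1, h2]
        · have h1 : F (Preorder.frestrictLe n y) = 0 := Set.indicator_of_notMem
            (s := {y : Finset.Iic n → X | ∀ i, y i ∉ D})
            (fun h => hy fun k hk => h ⟨k, Finset.mem_Iic.2 hk⟩) _
          have h2 : I n y = 0 :=
            Set.indicator_of_notMem (s := {y : ℕ → X | ∀ k ≤ n, y k ∉ D}) hy _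
          rw [h1, h2]
      calc ∫⁻ y, I (n + 1) y * W (y (n + 1)) ∂P
          ≤ ∫⁻ y, F (Preorder.frestrictLe n y) * W (y (n + 1)) ∂P := by
            refine lintegral_mono fun y => mul_le_mul_left ?_ _
            rw [hFI]
            exact Set.indicator_le_indicator_of_subset
              (show {y : ℕ → X | ∀ k ≤ n + 1, y k ∉ D} ⊆ {y | ∀ k ≤ n, y k ∉ D} from
                fun y hy k hk => hy k (by omega))
              (fun _ => zero_le) y
        _ = ∫⁻ y, F (Preorder.frestrictLe n y) * ∫⁻ z, W z ∂(κ (y n)) ∂P :=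
            lintegral_chainLaw_mul_succ hF hW
        _ ≤ ∫⁻ y, ρ * (I n y * W (y n)) ∂P := by
            refine lintegral_mono fun y => ?_
            rw [hFI]
            by_cases hy : ∀ k ≤ n, y k ∉ D
            · have : I n y = 1 := Set.indicator_of_mem (s := {y : ℕ → X | ∀ k ≤ n, y k ∉ D}) hy _
              rw [this, one_mul, one_mul]
              exact h _ (hy n le_rfl)
            · have : I n y = 0 :=
                Set.indicator_of_notMem (s := {y : ℕ → X | ∀ k ≤ n, y k ∉ D}) hy _
              simp [this]
        _ = ρ * ∫⁻ y, I n y * W (y n) ∂P :=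
            lintegral_const_mul _ ((hI n).mul (hW.comp (measurable_pi_apply n)))
        _ ≤ ρ * (ρ ^ n * W x) := by gcongr
        _ = _ := by rw [pow_succ', mul_assoc]
  calc ∫⁻ y, hittingTime D y ∂P ≤ ∫⁻ y, ∑' n, I n y ∂P :=
        lintegral_mono fun y => hittingTime_le_tsum D y
    _ = ∑' n, ∫⁻ y, I n y ∂P := lintegral_tsum fun n => (hI n).aemeasurable
    _ ≤ ∑' n, ρ ^ n * W x := by
        refine ENNReal.tsum_le_tsum fun n => (lintegral_mono fun y => ?_).trans (hw n)
        exact le_mul_of_one_le_right zero_le (h1 _)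
    _ = W x * (1 - ρ)⁻¹ := by rw [ENNReal.tsum_mul_right, ENNReal.tsum_geometric, mul_comm]

end GeometricDrift

/-! ### From the Lyapunov function to stability -/

section Lyapunov

variable {d : ℕ} {A : Type*} [Fintype A] [MeasurableSpace A] [DiscreteMeasurableSpace A]
  [Nonempty A] {γ Rmax : ℝ} {M : MDP d A γ Rmax} {L : State d → ℝ} {ν ν' B α : ℝ}

lemma abs_integral_increment_le (h : M.IsLyapunov L ν ν' B α) (s : State d) (a : A) :
    |∫ s', (L s' - L s) ∂(M.trans (s, a))| ≤ ν := by
  have := norm_integral_le_of_norm_le_const (μ := M.trans (s, a)) (f := fun s' => L s' - L s)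
    (C := ν) ((h.increment s a).mono fun s' hs' => hs'.1)
  simpa using this

/-- As `d ≥ 1`, the space is unbounded and `L → ∞` provides a state with `L > B`; the drift there
cannot exceed the largest increment. -/
lemma drift_le_increment (hd : 1 ≤ d) (h : M.IsLyapunov L ν ν' B α) : α ≤ ν := by
  have : Nonempty (Fin d) := ⟨⟨0, hd⟩⟩
  obtain ⟨s, hs⟩ := (h.tendsto.eventually_gt_atTop B).exists
  have h1 := h.drift s hs
  have h2 : -ν ≤ ∑ a, M.optPolicy s a * ∫ s', (L s' - L s) ∂(M.trans (s, a)) := by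
    calc -ν = ∑ a, M.optPolicy s a * (-ν) := by
          rw [← Finset.sum_mul, MDP.sum_optPolicy, one_mul]
      _ ≤ _ := Finset.sum_le_sum fun a _ => mul_le_mul_of_nonneg_left
          (abs_le.1 (abs_integral_increment_le h s a)).1 (MDP.optPolicy_nonneg s a)
  linarith

lemma lintegral_step (π : Policy d A) (s : State d) {g : State d → ℝ≥0∞} (hg : Measurable g) :
    ∫⁻ s', g s' ∂(M.step π s) =
      ∑ a, ENNReal.ofReal ((π.1 s).real {a}) * ∫⁻ s', g s' ∂(M.trans (s, a)) := by
  rw [MDP.step, Kernel.lintegral_comp _ _ _ hg, Kernel.lintegral_id_prod hg.lintegral_kernel,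
    lintegral_fintype]
  refine Finset.sum_congr rfl fun a _ => ?_
  rw [ofReal_measureReal, mul_comm]

lemma exp_le_one_add_add_sq {x : ℝ} (hx : |x| ≤ 1) : Real.exp x ≤ 1 + x + x ^ 2 := by
  linarith [(abs_le.1 (Real.abs_exp_sub_one_sub_id_le hx)).2]

lemma lintegral_exp_trans_le (h : M.IsLyapunov L ν ν' B α) {l : ℝ} (hl : 0 ≤ l)
    (hlν : l * ν ≤ 1) (s : State d) (a : A) :
    ∫⁻ s', ENNReal.ofReal (Real.exp (l * L s')) ∂(M.trans (s, a)) ≤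
      ENNReal.ofReal (Real.exp (l * L s) *
        (1 + l * ∫ s', (L s' - L s) ∂(M.trans (s, a)) + (l * ν) ^ 2)) := by
  have hm : Measurable fun s' => L s' - L s := h.measurable.sub_const _
  have hi : Integrable (fun s' => L s' - L s) (M.trans (s, a)) :=
    Integrable.of_bound hm.aestronglyMeasurable ν ((h.increment s a).mono fun s' hs' => hs'.1)
  have hi2 : Integrable (fun s' => Real.exp (l * L s) * (1 + l * (L s' - L s) + (l * ν) ^ 2))
      (M.trans (s, a)) :=
    (((integrable_const _).add (hi.const_mul _)).add (integrable_const _)).const_mul _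
  have hle : ∀ᵐ s' ∂(M.trans (s, a)), Real.exp (l * L s') ≤
      Real.exp (l * L s) * (1 + l * (L s' - L s) + (l * ν) ^ 2) := by
    filter_upwards [h.increment s a] with s' hs'
    have h1 : |l * (L s' - L s)| ≤ l * ν := by
      rw [abs_mul, abs_of_nonneg hl]
      exact mul_le_mul_of_nonneg_left hs'.1 hl
    have h2 := exp_le_one_add_add_sq (h1.trans hlν)
    have h3 : (l * (L s' - L s)) ^ 2 ≤ (l * ν) ^ 2 := by
      rw [← sq_abs (l * (L s' - L s))]
      gcongr
    calc Real.exp (l * L s') = Real.exp (l * L s) * Real.exp (l * (L s' - L s)) := by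
          rw [← Real.exp_add]; ring_nf
      _ ≤ _ := by gcongr; linarith
  calc _ ≤ ∫⁻ s', ENNReal.ofReal (Real.exp (l * L s) * (1 + l * (L s' - L s) + (l * ν) ^ 2))
          ∂(M.trans (s, a)) :=
        lintegral_mono_ae (hle.mono fun s' hs' => ENNReal.ofReal_le_ofReal hs')
    _ = ENNReal.ofReal (∫ s', Real.exp (l * L s) * (1 + l * (L s' - L s) + (l * ν) ^ 2)
          ∂(M.trans (s, a))) := by
        rw [ofReal_integral_eq_lintegral_ofReal hi2]
        exact hle.mono fun s' hs' => (Real.exp_pos _).le.trans hs'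
    _ = _ := by
        have e : Integrable (fun s' => 1 + l * (L s' - L s)) (M.trans (s, a)) :=
          (integrable_const _).add (hi.const_mul _)
        rw [integral_const_mul, integral_add e (integrable_const _),
          integral_add (integrable_const _) (hi.const_mul _), integral_const_mul]
        simp

/-- The exponential of the Lyapunov function contracts in expectation outside of a sublevel set,
for every policy close to `π^*`. -/
lemma lintegral_exp_step_le (h : M.IsLyapunov L ν ν' B α) (hαν : α ≤ ν) {π : Policy d A}
    (hπ : ∀ s, ∑ a, |(π.1 s).real {a} - M.optPolicy s a| ≤ α / (2 * ν)) {s : State d}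
    (hs : B < L s) :
    ∫⁻ s', ENNReal.ofReal (Real.exp (α / (4 * ν ^ 2) * L s')) ∂(M.step π s) ≤
      ENNReal.ofReal (1 - α ^ 2 / (16 * ν ^ 2)) *
        ENNReal.ofReal (Real.exp (α / (4 * ν ^ 2) * L s)) := by
  have hν := h.ν_pos
  have hα := h.α_pos
  -- This `l` minimizes `(lν)² - lα / 2`, with minimum `-α² / (16ν²)`.
  set l := α / (4 * ν ^ 2)
  have hl : 0 ≤ l := by positivity
  have hlν : l * ν = α / ν / 4 := by simp only [l]; field_simp
  have hu : α / ν ≤ 1 := (div_le_one hν).2 hαν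
  have hlν1 : l * ν ≤ 1 := by rw [hlν]; linarith
  set m : A → ℝ := fun a => ∫ s', (L s' - L s) ∂(M.trans (s, a))
  have hm : ∀ a, |m a| ≤ ν := abs_integral_increment_le h s
  -- Changing the policy by `α / (2ν)` in total changes the drift by at most `ν` times that, hence
  -- uses up half of `α`.
  have hdrift : ∑ a, (π.1 s).real {a} * m a ≤ -α / 2 := by
    have h1 := h.drift s hs
    have h2 : ∑ a, (π.1 s).real {a} * m a - ∑ a, M.optPolicy s a * m a ≤ α / 2 := by
      rw [← Finset.sum_sub_distrib]
      calc ∑ a, ((π.1 s).real {a} * m a - M.optPolicy s a * m a)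
          ≤ ∑ a, |(π.1 s).real {a} - M.optPolicy s a| * ν := by
            refine Finset.sum_le_sum fun a _ => ?_
            rw [← sub_mul]
            refine (le_abs_self _).trans ?_
            rw [abs_mul]
            exact mul_le_mul_of_nonneg_left (hm a) (abs_nonneg _)
        _ ≤ α / (2 * ν) * ν := by
            rw [← Finset.sum_mul]
            exact mul_le_mul_of_nonneg_right (hπ s) hν.le
        _ = α / 2 := by field_simp
    change ∑ a, M.optPolicy s a * m a ≤ -α at h1
    linarith
  have hmeas : Measurable fun s' => ENNReal.ofReal (Real.exp (l * L s')) :=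
    (h.measurable.const_mul l).exp.ennreal_ofReal
  have hpos : ∀ a, 0 ≤ 1 + l * m a + (l * ν) ^ 2 := by
    intro a
    have : l * -ν ≤ l * m a := mul_le_mul_of_nonneg_left (abs_le.1 (hm a)).1 hl
    nlinarith [sq_nonneg (l * ν)]
  rw [lintegral_step π s hmeas]
  calc _ ≤ ∑ a, ENNReal.ofReal ((π.1 s).real {a}) *
          ENNReal.ofReal (Real.exp (l * L s) * (1 + l * m a + (l * ν) ^ 2)) :=
        Finset.sum_le_sum fun a _ => by
          gcongr
          exact lintegral_exp_trans_le h hl hlν1 s a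
    _ = ENNReal.ofReal (∑ a, (π.1 s).real {a} *
          (Real.exp (l * L s) * (1 + l * m a + (l * ν) ^ 2))) := by
        rw [ENNReal.ofReal_sum_of_nonneg fun a _ => mul_nonneg measureReal_nonneg
          (mul_nonneg (Real.exp_pos _).le (hpos a))]
        exact Finset.sum_congr rfl fun a _ => (ENNReal.ofReal_mul measureReal_nonneg).symm
    _ ≤ _ := by
        rw [← ENNReal.ofReal_mul' (Real.exp_pos _).le]
        refine ENNReal.ofReal_le_ofReal ?_
        have e1 : ∑ a, (π.1 s).real {a} * (Real.exp (l * L s) * (1 + l * m a + (l * ν) ^ 2)) =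
            Real.exp (l * L s) * ((1 + (l * ν) ^ 2) + l * ∑ a, (π.1 s).real {a} * m a) := by
          have e0 : 1 + (l * ν) ^ 2 = ∑ a, (π.1 s).real {a} * (1 + (l * ν) ^ 2) := by
            rw [← Finset.sum_mul, MDP.sum_policy_eq_one, one_mul]
          conv_rhs => rw [e0]
          rw [Finset.mul_sum, ← Finset.sum_add_distrib, Finset.mul_sum]
          exact Finset.sum_congr rfl fun a _ => by ring
        rw [e1, mul_comm]
        refine mul_le_mul_of_nonneg_right ?_ (Real.exp_pos _).le
        have e2 := mul_le_mul_of_nonneg_left hdrift hl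
        have e3 : (l * ν) ^ 2 + l * (-α / 2) = -(α ^ 2 / (16 * ν ^ 2)) := by
          simp only [l]
          field_simp
          ring
        linarith

lemma lintegral_exp_step_le_of_le (h : M.IsLyapunov L ν ν' B α) (π : Policy d A) {l : ℝ}
    (hl : 0 ≤ l) {s : State d} (hs : L s ≤ B) :
    ∫⁻ s', ENNReal.ofReal (Real.exp (l * L s')) ∂(M.step π s) ≤
      ENNReal.ofReal (Real.exp (l * (B + ν))) := by
  rw [lintegral_step π s (h.measurable.const_mul l).exp.ennreal_ofReal]
  calc _ ≤ ∑ a, ENNReal.ofReal ((π.1 s).real {a}) * ENNReal.ofReal (Real.exp (l * (B + ν))) := by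
        refine Finset.sum_le_sum fun a _ => ?_
        gcongr
        calc _ ≤ ∫⁻ _, ENNReal.ofReal (Real.exp (l * (B + ν))) ∂(M.trans (s, a)) := by
              refine lintegral_mono_ae ((h.increment s a).mono fun s' hs' => ?_)
              refine ENNReal.ofReal_le_ofReal (Real.exp_le_exp.2 ?_)
              refine mul_le_mul_of_nonneg_left ?_ hl
              linarith [(abs_le.1 hs'.1).2]
          _ = _ := by simp
    _ = _ := by
        rw [← Finset.sum_mul, ← ENNReal.ofReal_sum_of_nonneg fun a _ => measureReal_nonneg,
          MDP.sum_policy_eq_one, ENNReal.ofReal_one, one_mul]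

/-- `W = exp (l L)` contracts where `L > B` and has bounded one-step mean elsewhere. A single drift
inequality thus gives both halves of stability, with a sublevel set of `L` as `D`. -/
theorem isStable_of_close (hd : 1 ≤ d) (h : M.IsLyapunov L ν ν' B α) {π : Policy d A}
    (hπ : ∀ s, ∑ a, |(π.1 s).real {a} - M.optPolicy s a| ≤ α / (2 * ν)) :
    M.IsStable fun _ => π := by
  have hν := h.ν_pos
  have hα := h.α_pos
  have hαν := drift_le_increment hd h
  set l := α / (4 * ν ^ 2)
  have hl : 0 < l := by positivity
  set W : State d → ℝ≥0∞ := fun s => ENNReal.ofReal (Real.exp (l * L s))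
  set ρ : ℝ≥0∞ := ENNReal.ofReal (1 - α ^ 2 / (16 * ν ^ 2))
  set b : ℝ≥0∞ := ENNReal.ofReal (Real.exp (l * (B + ν)))
  have hW : Measurable W := (h.measurable.const_mul l).exp.ennreal_ofReal
  have hρ : ρ < 1 := by
    rw [← ENNReal.ofReal_one]
    have : 0 < α ^ 2 / (16 * ν ^ 2) := by positivity
    exact (ENNReal.ofReal_lt_ofReal_iff one_pos).2 (by linarith)
  have hout : ∀ s, B < L s → ∫⁻ s', W s' ∂(M.step π s) ≤ ρ * W s := fun s hs =>
    lintegral_exp_step_le h hαν hπ hs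
  have hall : ∀ s, ∫⁻ s', W s' ∂(M.step π s) ≤ ρ * W s + b := by
    intro s
    rcases le_or_gt (L s) B with hs | hs
    · exact (lintegral_exp_step_le_of_le h π hl.le hs).trans le_add_self
    · exact (hout s hs).trans le_self_add
  have hW1 : ∀ s, 1 ≤ W s := fun s => by
    rw [← ENNReal.ofReal_one]
    exact ENNReal.ofReal_le_ofReal (Real.one_le_exp (mul_nonneg hl.le (h.nonneg s)))
  have hρ' : (1 - ρ)⁻¹ ≠ ∞ := by
    rw [ENNReal.inv_ne_top]
    exact (tsub_pos_of_lt hρ).ne'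
  have hc : b * (1 - ρ)⁻¹ ≠ ∞ := ENNReal.mul_ne_top ENNReal.ofReal_ne_top hρ'
  intro θ hθ _
  -- `r ≥ B` keeps the contraction valid off `D`; the size of `exp (l r)` brings the limsup below
  -- `θ`.
  obtain ⟨r, hrB, hr⟩ : ∃ r, B ≤ r ∧ (b * (1 - ρ)⁻¹).toReal / θ ≤ Real.exp (l * r) := by
    have ht : Tendsto (fun r : ℝ => Real.exp (l * r)) atTop atTop :=
      Real.tendsto_exp_atTop.comp (tendsto_id.const_mul_atTop hl)
    exact ((eventually_ge_atTop B).and (ht.eventually_ge_atTop _)).exists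
  have hD : MeasurableSet {s | L s ≤ r} := measurableSet_le h.measurable measurable_const
  refine ⟨{s | L s ≤ r}, h.bounded r, hD, fun s => ?_, fun s => ?_⟩
  · refine (limsup_chainLaw_le (κ := M.step π) (b := b) hW hρ hall (x := s)
      ENNReal.ofReal_ne_top (D := {s | L s ≤ r}) (w := ENNReal.ofReal (Real.exp (l * r)))
      (by simpa using Real.exp_pos _) ENNReal.ofReal_ne_top fun y hy => ?_).trans ?_
    · refine ENNReal.ofReal_le_ofReal (Real.exp_le_exp.2 (mul_le_mul_of_nonneg_left ?_ hl.le))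
      exact (not_le.1 hy).le
    · rw [← ENNReal.ofReal_toReal hc, ← ENNReal.ofReal_div_of_pos (Real.exp_pos _)]
      refine ENNReal.ofReal_le_ofReal ?_
      rw [div_le_iff₀ (Real.exp_pos _)]
      rw [div_le_iff₀ hθ] at hr
      linarith
  · have hb : ∀ _t : ℕ, ∫⁻ x, hittingTime {s | L s ≤ r} x ∂(M.stateLaw (fun _ => π) _t s) ≤
        W s * (1 - ρ)⁻¹ := fun _ =>
      lintegral_hittingTime_le (κ := M.step π) hW hW1 hD
        (fun y hy => hout y (hrB.trans_lt (not_le.1 hy))) s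
    exact (iSup_le hb).trans_lt (ENNReal.mul_lt_top ENNReal.ofReal_lt_top hρ'.lt_top)

end Lyapunov

/-! ### Orders of magnitude as `α → 0` -/

section Asymptotics

/-- Used with `y = 1 / α`: since `log y ≥ 1`, the constant `log k` is absorbed into a multiple of
`log y`. -/
lemma log_le_of_le_mul_sq {k u y : ℝ} (hk : 0 < k) (hu : 0 < u) (hy : 0 < y)
    (hy1 : 1 ≤ Real.log y) (h : u ≤ k * y ^ 2) :
    Real.log u ≤ (|Real.log k| + 2) * Real.log y := by
  have h1 := Real.log_le_log hu h
  rw [Real.log_mul hk.ne' (by positivity), Real.log_pow] at h1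
  have h2 := le_abs_self (Real.log k)
  have h3 : |Real.log k| ≤ |Real.log k| * Real.log y :=
    le_mul_of_one_le_right (abs_nonneg _) hy1
  push_cast at h1
  linarith

variable {γ Rmax ν Δ : ℝ} {cA : ℕ}

/-- Each of the four terms of `τ(α)` is at least linear in `α`; for the gap term the crude `log x ≤
x` is enough. -/
lemma exists_mul_le_tauMax (hγ1 : γ < 1) (hR : 0 < Rmax) (hν : 0 < ν) (hΔ : 0 < Δ)
    (hA : 1 ≤ cA) :
    ∃ c : ℝ, 0 < c ∧ ∀ α, 0 < α → α ≤ 1 → α ≤ ν → c * α ≤ tauMax γ Rmax ν Δ cA α := by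
  have hA' : (1 : ℝ) ≤ cA := by exact_mod_cast hA
  have hγ : 0 < 1 - γ := by linarith
  refine ⟨min (min (Real.sqrt (1 / (24 * ν))) ((1 - γ) / (8 * Rmax)))
    (min ((1 - γ) / (48 * Rmax * (cA : ℝ) ^ 2 * ν)) (Δ / (24 * ν * cA))), ?_, ?_⟩
  · refine lt_min (lt_min ?_ ?_) (lt_min ?_ ?_) <;> positivity
  · intro α hα hα1 hαν
    set c := min (min (Real.sqrt (1 / (24 * ν))) ((1 - γ) / (8 * Rmax)))
      (min ((1 - γ) / (48 * Rmax * (cA : ℝ) ^ 2 * ν)) (Δ / (24 * ν * cA)))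
    have h1 : c ≤ Real.sqrt (1 / (24 * ν)) := (min_le_left _ _).trans (min_le_left _ _)
    have h2 : c ≤ (1 - γ) / (8 * Rmax) := (min_le_left _ _).trans (min_le_right _ _)
    have h3 : c ≤ (1 - γ) / (48 * Rmax * (cA : ℝ) ^ 2 * ν) :=
      (min_le_right _ _).trans (min_le_left _ _)
    have h4 : c ≤ Δ / (24 * ν * cA) := (min_le_right _ _).trans (min_le_right _ _)
    refine le_min (le_min ?_ ?_) (le_min ?_ ?_)
    · calc c * α ≤ Real.sqrt (1 / (24 * ν)) * Real.sqrt α := by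
            gcongr
            exact Real.le_sqrt_of_sq_le (by nlinarith)
        _ = Real.sqrt (α / (24 * ν)) := by
            rw [← Real.sqrt_mul (by positivity)]
            congr 1
            ring
    · calc c * α ≤ (1 - γ) / (8 * Rmax) * 1 := by gcongr
        _ = _ := mul_one _
    · calc c * α ≤ (1 - γ) / (48 * Rmax * (cA : ℝ) ^ 2 * ν) * α := by gcongr
        _ = _ := by ring
    · have hlog : 0 < Real.log (24 * ν * cA / α) := by
        refine Real.log_pos ?_
        rw [lt_div_iff₀ hα]
        nlinarith
      have hle : Real.log (24 * ν * cA / α) ≤ 24 * ν * cA / α := by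
        have := Real.log_le_sub_one_of_pos (by positivity : 0 < 24 * ν * cA / α)
        linarith
      calc c * α ≤ Δ / (24 * ν * cA) * α := by gcongr
        _ = Δ / (24 * ν * cA / α) := by field_simp
        _ ≤ _ := by gcongr

variable {d : ℕ} {ζ ν' κ c : ℝ}

lemma exists_complexity_bound (hd : 1 ≤ d) (hγ0 : 0 < γ) (hγ1 : γ < 1) (hR : 0 < Rmax)
    (hν : 0 < ν) (hν' : 0 < ν') (hΔ : 0 < Δ) (hζ : 0 < ζ) (hκ : 0 < κ) (hc : 0 < c)
    (hA : 1 ≤ cA) :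
    ∃ K' α₀ : ℝ, 0 < K' ∧ 0 < α₀ ∧ ∀ α, 0 < α → α < α₀ → ∀ τ δ : ℝ,
      c * tauMax γ Rmax ν Δ cA α ≤ τ → τ ≤ tauMax γ Rmax ν Δ cA α → δ = τ ^ 2 →
      0 < δ ∧ δ < 1 ∧
      (depth γ δ * max 1 (1 / mesh d γ Rmax ζ δ) * (2 * ν' + Real.sqrt d + 2)) ^ d *
          (cA * ⌈κ * widthOrder d γ Rmax ζ cA δ⌉₊) ≤
        K' * (1 / α) ^ (2 * d + 4) * Real.log (1 / α) ^ (d + 1) := by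
  obtain ⟨c₁, hc₁, hτlow⟩ := exists_mul_le_tauMax (γ := γ) hγ1 hR hν hΔ hA
  have hA' : (0 : ℝ) < cA := by exact_mod_cast hA
  have hd' : (0 : ℝ) < d := by exact_mod_cast hd
  have hγ : 0 < 1 - γ := by linarith
  have hlγ : 0 < Real.log (1 / γ) := Real.log_pos ((one_lt_div hγ0).2 hγ1)
  set k := 1 / (c * c₁) ^ 2
  have hk : 0 < k := by positivity
  set g := 2 * ζ * γ * Real.sqrt d / (Rmax / (1 - γ) * (1 - γ))
  have hg : 0 < g := by positivity
  set h := (|Real.log k| + 2) / Real.log (1 / γ) + 1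
  have hh : 0 < h := by positivity
  set w := (|Real.log (2 * cA * k)| + 2) + d * h + d * (|Real.log (g * k)| + 2)
  have hw : 0 < w := by positivity
  set q := γ ^ 2 * k ^ 2 / (1 - γ) ^ 2
  set b := 2 * ν' + Real.sqrt d + 2
  have hb : 0 < b := by positivity
  -- `α < exp (-1)` makes `log (1 / α) ≥ 1`, which absorbs additive constants; `α < ν` is needed for
  -- the lower bound on `τ(α)` and for `δ < 1`.
  refine ⟨(h * (1 + g * k) * b) ^ d * (cA * (κ * (q * w) + 1)), min (Real.exp (-1)) ν,
    by positivity, lt_min (Real.exp_pos _) hν, ?_⟩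
  intro α hα hα₀ τ δ hτ1 hτ2 hδ
  have hαe : α < Real.exp (-1) := hα₀.trans_le (min_le_left _ _)
  have hαν : α < ν := hα₀.trans_le (min_le_right _ _)
  have hα1 : α ≤ 1 := hαe.le.trans (Real.exp_le_one_iff.2 (by norm_num))
  have hτα : c * c₁ * α ≤ τ := by
    rw [mul_assoc]
    exact (mul_le_mul_of_nonneg_left (hτlow α hα hα1 hαν.le) hc.le).trans hτ1
  have hτ : 0 < τ := lt_of_lt_of_le (by positivity) hτα
  have hδ0 : 0 < δ := by rw [hδ]; positivity
  have hδ1 : δ < 1 := by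
    have h1 := sq_le_of_le_tauMax hν hα hτ hτ2
    rw [← hδ] at h1
    have : α / (24 * ν) < 1 := by
      rw [div_lt_one (by positivity)]
      linarith
    linarith
  refine ⟨hδ0, hδ1, ?_⟩
  set y := 1 / α
  have hy1 : 1 ≤ y := by rw [le_div_iff₀ hα]; linarith
  have hy : 0 < y := by linarith
  set l := Real.log y
  have hl : 1 ≤ l := by
    simp only [l, y]
    rw [one_div, Real.log_inv]
    have := Real.log_lt_log hα hαe
    rw [Real.log_exp] at this
    linarith
  have hδinv : 1 / δ ≤ k * y ^ 2 := by
    have : (c * c₁ * α) ^ 2 ≤ δ := by rw [hδ]; gcongr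
    calc 1 / δ ≤ 1 / (c * c₁ * α) ^ 2 := one_div_le_one_div_of_le (by positivity) this
      _ = k * y ^ 2 := by simp only [k, y]; field_simp
  have hH : (depth γ δ : ℝ) ≤ h * l := by
    have h0 := Real.logb_pos_of_base_lt_one hγ0 hγ1 hδ0 hδ1
    have h1 := (Nat.ceil_lt_add_one h0.le).le
    have h2 : Real.logb γ δ = Real.log (1 / δ) / Real.log (1 / γ) := by
      rw [Real.logb, one_div, one_div, Real.log_inv, Real.log_inv, neg_div_neg_eq]
    have h3 := log_le_of_le_mul_sq hk (by positivity) hy hl hδinv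
    calc (depth γ δ : ℝ) ≤ Real.logb γ δ + 1 := h1
      _ ≤ (|Real.log k| + 2) * l / Real.log (1 / γ) + 1 * l := by
          rw [h2, one_mul]
          gcongr
      _ = h * l := by simp only [h]; ring
  have hεinv : 1 / mesh d γ Rmax ζ δ = g * (1 / δ) := by
    unfold mesh
    simp only [g]
    field_simp
  have hεinv' : 1 / mesh d γ Rmax ζ δ ≤ g * k * y ^ 2 := by
    rw [hεinv, mul_assoc]
    gcongr
  have hm : max 1 (1 / mesh d γ Rmax ζ δ) ≤ (1 + g * k) * y ^ 2 := by
    have h1 : 1 ≤ y ^ 2 := one_le_pow₀ hy1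
    have h2 : 0 ≤ g * k * y ^ 2 := by positivity
    refine max_le ?_ ?_ <;> rw [add_mul, one_mul] <;> linarith
  have hW : widthOrder d γ Rmax ζ cA δ ≤ q * w * (y ^ 4 * l) := by
    have e1 : Real.log (2 * cA / δ) ≤ (|Real.log (2 * cA * k)| + 2) * l := by
      refine log_le_of_le_mul_sq (by positivity) (by positivity) hy hl ?_
      calc 2 * cA / δ = 2 * cA * (1 / δ) := by ring
        _ ≤ 2 * cA * (k * y ^ 2) := by gcongr
        _ = _ := by ring
    -- Bounding `log H` by `H` is wasteful but still of order `log (1 / α)`.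
    have e2 : Real.log (depth γ δ) ≤ h * l :=
      (Real.log_le_self (Nat.cast_nonneg _)).trans hH
    have e3 : max 0 (Real.log (1 / mesh d γ Rmax ζ δ)) ≤ (|Real.log (g * k)| + 2) * l :=
      max_le (by positivity) (log_le_of_le_mul_sq (by positivity)
        (by rw [hεinv]; positivity) hy hl hεinv')
    have e4 : γ ^ 2 / ((1 - γ) ^ 2 * δ ^ 2) ≤ q * y ^ 4 := by
      calc γ ^ 2 / ((1 - γ) ^ 2 * δ ^ 2) = γ ^ 2 / (1 - γ) ^ 2 * (1 / δ) ^ 2 := by field_simp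
        _ ≤ γ ^ 2 / (1 - γ) ^ 2 * (k * y ^ 2) ^ 2 := by gcongr
        _ = q * y ^ 4 := by simp only [q]; ring
    have e5 : 0 ≤ Real.log (2 * cA / δ) + d * Real.log (depth γ δ) +
        d * max 0 (Real.log (1 / mesh d γ Rmax ζ δ)) := by
      have h1 : 0 ≤ Real.log (2 * cA / δ) := by
        refine Real.log_nonneg ?_
        rw [le_div_iff₀ hδ0]
        have : (1 : ℝ) ≤ cA := by exact_mod_cast hA
        linarith
      have h2 := Real.log_natCast_nonneg (depth γ δ)
      have h3 := le_max_left 0 (Real.log (1 / mesh d γ Rmax ζ δ))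
      positivity
    unfold widthOrder
    calc _ ≤ q * y ^ 4 * ((|Real.log (2 * cA * k)| + 2) * l + d * (h * l) +
          d * ((|Real.log (g * k)| + 2) * l)) := by
          refine mul_le_mul e4 (by gcongr) e5 (by positivity)
      _ = q * w * (y ^ 4 * l) := by simp only [w]; ring
  have hyl : 1 ≤ y ^ 4 * l := one_le_mul_of_one_le_of_one_le (one_le_pow₀ hy1) hl
  have hCle : (⌈κ * widthOrder d γ Rmax ζ cA δ⌉₊ : ℝ) ≤ (κ * (q * w) + 1) * (y ^ 4 * l) := by
    rw [add_mul, one_mul]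
    have h1 : κ * widthOrder d γ Rmax ζ cA δ ≤ κ * (q * w) * (y ^ 4 * l) := by
      rw [mul_assoc]
      gcongr
    calc (⌈κ * widthOrder d γ Rmax ζ cA δ⌉₊ : ℝ) ≤ (⌈κ * (q * w) * (y ^ 4 * l)⌉₊ : ℝ) := by
          exact_mod_cast Nat.ceil_mono h1
      _ ≤ κ * (q * w) * (y ^ 4 * l) + 1 := (Nat.ceil_lt_add_one (by positivity)).le
      _ ≤ _ := by linarith
  calc _ ≤ (h * l * ((1 + g * k) * y ^ 2) * b) ^ d *
        (cA * ((κ * (q * w) + 1) * (y ^ 4 * l))) := by gcongr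
    _ = _ := by
      rw [pow_add y, pow_mul y, pow_succ l]
      simp only [mul_pow]
      ring

end Asymptotics

end StableRL

end

theorem theorem2 (d : ℕ) (hd : 1 ≤ d) (A : Type*) [Fintype A] [Nonempty A] [MeasurableSpace A]
    [DiscreteMeasurableSpace A] (γ Rmax ν' : ℝ) (hγ0 : 0 < γ) (hγ1 : γ < 1) (hR : 0 < Rmax)
    (hν' : 0 < ν') :
    ∃ K : ℝ, 0 < K ∧
      -- stability
      (∀ (M : StableRL.MDP d A γ Rmax) (L : StableRL.State d → ℝ) (ν B α ζ Δ : ℝ),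
        M.IsLyapunov L ν ν' B α → 0 < ζ → M.LipschitzValue ζ →
        0 < Δ → (Δ : EReal) ≤ M.minGap →
        ∀ τ δ : ℝ, 0 < τ → τ ≤ StableRL.tauMax γ Rmax ν Δ (Fintype.card A) α → δ = τ ^ 2 →
        ∀ C : ℕ, K * StableRL.widthOrder d γ Rmax ζ (Fintype.card A) δ ≤ C →
        ∀ S : StableRL.State d → StableRL.State d,
          StableRL.IsNearestGridMap (StableRL.mesh d γ Rmax ζ δ) S →
          ∃ π : StableRL.Policy d A,
            M.IsOraclePolicy τ (StableRL.depth γ δ) C S π ∧ M.IsStable fun _ => π) ∧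
      -- number of simulation steps per time step, as `α → 0`
      (∀ κ c ν ζ Δ : ℝ, K ≤ κ → 0 < c → c ≤ 1 → 0 < ν → 0 < ζ → 0 < Δ →
        ∃ K' α₀ : ℝ, 0 < K' ∧ 0 < α₀ ∧
          ∀ (M : StableRL.MDP d A γ Rmax) (L : StableRL.State d → ℝ) (B α : ℝ), α < α₀ →
          M.IsLyapunov L ν ν' B α → M.LipschitzValue ζ → (Δ : EReal) ≤ M.minGap →
          ∀ τ δ : ℝ, c * StableRL.tauMax γ Rmax ν Δ (Fintype.card A) α ≤ τ →
          τ ≤ StableRL.tauMax γ Rmax ν Δ (Fintype.card A) α → δ = τ ^ 2 →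
          ∀ C : ℕ, C = ⌈κ * StableRL.widthOrder d γ Rmax ζ (Fintype.card A) δ⌉₊ →
          ∀ S : StableRL.State d → StableRL.State d,
            StableRL.IsNearestGridMap (StableRL.mesh d γ Rmax ζ δ) S →
            ∀ s, ∀ᵐ ω ∂(M.samplesLaw C),
              (StableRL.sampleCount S ω (StableRL.depth γ δ) s : ℝ) ≤
                K' * (1 / α) ^ (2 * d + 4) * Real.log (1 / α) ^ (d + 1)) := by

  have hA : 1 ≤ Fintype.card A := Fintype.card_pos
  -- The union bound alone dictates `K`.
  refine ⟨StableRL.widthConst d ν', StableRL.widthConst_pos hν', ?_, ?_⟩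
  · intro M L ν B α ζ Δ hLyap hζ hLip _ hgap τ δ hτ hτle hδ C hC S hS
    have hαν := StableRL.drift_le_increment hd hLyap
    have hν := hLyap.ν_pos
    have hα := hLyap.α_pos
    have hδ1 : δ ≤ 1 / 2 := by
      rw [hδ]
      refine (StableRL.sq_le_of_le_tauMax hν hα hτ hτle).trans ?_
      rw [div_le_iff₀ (by positivity)]
      linarith
    obtain ⟨π, hπ⟩ := StableRL.exists_isOraclePolicy M (C := C) hS.measurable
      hS.countable_range τ (StableRL.depth γ δ)
    refine ⟨π, hπ, StableRL.isStable_of_close hd hLyap fun s => ?_⟩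
    refine (StableRL.sum_abs_oraclePolicy_sub_optPolicy_le hd hR hν' hζ hτ hδ hδ1
      (fun s a => (hLyap.increment s a).mono fun _ h => h.2) hLip hgap hC hS hπ s).trans ?_
    rw [hδ]
    exact StableRL.policy_distance_le hγ1 hR hν hα hαν hA hτ hτle
  · intro κ c ν ζ Δ hκ hc _ hν hζ hΔ
    obtain ⟨K', α₀, hK', hα₀, hbound⟩ := StableRL.exists_complexity_bound hd hγ0 hγ1 hR hν hν' hΔ
      hζ ((StableRL.widthConst_pos hν').trans_le hκ) hc hA
    refine ⟨K', α₀, hK', hα₀, ?_⟩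
    intro M L B α hα hLyap _ _ τ δ hτ1 hτ2 hδ C hC S hS s
    obtain ⟨hδ0, hδ1, hle⟩ := hbound α hLyap.α_pos hα τ δ hτ1 hτ2 hδ
    have hε := StableRL.mesh_pos hd hγ0 hγ1 hR hζ hδ0
    obtain ⟨G, hG, hcard⟩ := StableRL.exists_finset_visited hd hε hν'
      (StableRL.depth_pos hγ0 hγ1 hδ0 hδ1) hS s
    filter_upwards [StableRL.ae_samplesLaw_norm_sub_le M (C := C)
      (fun s a => (hLyap.increment s a).mono fun _ h => h.2) G] with ω hω
    have h1 := StableRL.sampleCount_le (hS.norm_sub_le hε) hν'.le (by positivity) hG hω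
    have h2 : (StableRL.sampleCount S ω (StableRL.depth γ δ) s : ℝ) ≤
        G.card * (Fintype.card A * C) := by exact_mod_cast h1
    refine h2.trans (le_trans ?_ hle)
    rw [← hC]
    gcongr
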